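/- **Setting.** A closed set $\mathcal S\subset\mathbb R^d$ is *admissible* if there is $\delta>0$ such that $q\mapsto \mathrm{dist}(q,\mathcal S)$ is differentiable on $(\mathcal S+\delta)\setminus\mathcal S$, where $\mathcal S+\delta=\{q:\mathrm{dist}(q,\mathcal S)<\delta\}$. Let $\mathcal Q=\mathbb R^d\setminus\bigcup_{\ell=1}^m\mathcal S_\ell$ with $m\ge 0$ and $\mathcal S_1,\dots,\mathcal S_m$ admissible (so $\mathcal Q=\mathbb R^d$ if $m=0$). Let $j=(j^0,J)$ be a *current vector field*: a $C^1$ vector field on $\mathbb R\times\mathcal Q$ with $\partial_t j^0+\nabla_q\cdot J=0$, with $j^0>0$ wherever $j\neq0$, and with $\int_{\mathcal Q}j^0(t,q)\,dq=1$ for all $t\in\mathbb R$. Points where $j=0$ are called *nodes*. Let $\mu_t(dq)=j^0(t,q)\,dq$ on $\mathcal Q$. For $q\in\mathcal Q$ with $j(0,q)\ne0$ let $Q_q$ be the maximal solution, in $\mathcal Q$ and off the nodes, of $$\frac{dQ}{dt}(t)=\frac{J(t,Q(t))}{j^0(t,Q(t))},\qquad Q(0)=q. \tag{1}$$ Let $\varphi_t:\mathcal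 Q\to\mathcal Q\cup\{\dagger\}$ be the flow map: $\varphi_t(q)=Q_q(t)$ if $j(0,q)\neq 0$ and $t$ lies in the domain of $Q_q$; $\varphi_0(q)=q$ for all $q$; and $\varphi_t(q)=\dagger$ (a cemetery point) otherwise. The family $(\mu_t)$ is *equivariant* on an interval $I$ if $\mu_0\circ\varphi_t^{-1}=\mu_t$ for all $t\in I$. **Theorem.** Let $T>0$ and suppose that for every bounded Borel set $B\subset\mathcal Q$ $$\int_0^T dt\int_{\varphi_t(B)\setminus\{\dagger\}}dq\,\Bigl|\Bigl(\frac{\partial}{\partial t}+\frac{J}{j^0}\cdot\nabla_q\Bigr)j^0(t,q)\Bigr|<\infty, \tag{2}$$ $$\int_0^T dt\int_{\varphi_t(B)\setminus\{\dagger\}}dq\,\Bigl|J(t,q)\cdot\frac{q}{|q|}\Bigr|<\infty, \tag{3}$$ and that for every $\ell\in\{1,\dots,m\}$ there is $\delta>0$ such that for every bounded Borel set $B\subset\mathcal Q$ $$\int_0^T dt\int_{\varphi_t(B)\setminus\{\dagger\}}dq\;\mathbf 1\bigl(q\in\mathcal S_\ell+\delta\bigr)\,\frac{|J(t,q)\cdot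 e_\ell(q)|}{\mathrm{dist}(q,\mathcal S_\ell)}<\infty, \tag{4}$$ where $e_\ell(q)=-\nabla_q\,\mathrm{dist}(q,\mathcal S_\ell)$. Then for $\mu_0$-almost every $q\in\mathcal Q$ the solution of (1) exists at least up to time $T$ (on an interval containing $[0,T]$), and the family $(\mu_t)$ is equivariant on $[0,T]$. In particular, if (2), (3) and (4) hold for every $T>0$, then for $\mu_0$-almost every $q\in\mathcal Q$ the solution of (1) exists for all times $t\ge 0$. -/

import Mathlib

open MeasureTheory Set
open scoped Gradient

noncomputable section

namespace BohmFlow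

/-- `ℝ^d` with the Euclidean norm and Lebesgue measure. -/
abbrev Space (d : ℕ) : Type := EuclideanSpace ℝ (Fin d)

/-- A closed set `S` is admissible if its distance function is differentiable on
`(S + δ) \ S` for some `δ > 0`, where `S + δ` is the open `δ`-neighbourhood of `S`. -/
def Admissible {d : ℕ} (S : Set (Space d)) : Prop :=
  IsClosed S ∧ ∃ δ : ℝ, 0 < δ ∧
    DifferentiableOn ℝ (fun q => Metric.infDist q S) (Metric.thickening δ S \ S)

/-- The configuration space `ℝ^d \ ⋃ ℓ, S ℓ`; it is `ℝ^d` itself when `m = 0`. -/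
def conf {d m : ℕ} (S : Fin m → Set (Space d)) : Set (Space d) := (⋃ ℓ, S ℓ)ᶜ

/-- The time component `j⁰(t, q)` of a vector field on space-time. -/
def density {d : ℕ} (j : ℝ × Space d → ℝ × Space d) (t : ℝ) (q : Space d) : ℝ := (j (t, q)).1

/-- The spatial component `J(t, q)` of a vector field on space-time. -/
def flux {d : ℕ} (j : ℝ × Space d → ℝ × Space d) (t : ℝ) (q : Space d) : Space d := (j (t, q)).2

/-- The velocity `J / j⁰`; it is used only where `j ≠ 0`. -/
def velocity {d : ℕ} (j : ℝ × Space d → ℝ × Space d) (t : ℝ) (q : Space d) : Space d :=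
  (density j t q)⁻¹ • flux j t q

/-- The space-time divergence `∂_t j⁰ + ∑ i, ∂_i J^i`. -/
def divergence {d : ℕ} (j : ℝ × Space d → ℝ × Space d) (t : ℝ) (q : Space d) : ℝ :=
  deriv (fun s => density j s q) t +
    ∑ i : Fin d, fderiv ℝ (fun x => flux j t x i) q (EuclideanSpace.single i 1)

/-- The derivative of `j⁰` along the motion, `(∂_t + (J / j⁰) · ∇_q) j⁰`. -/
def materialDeriv {d : ℕ} (j : ℝ × Space d → ℝ × Space d) (t : ℝ) (q : Space d) : ℝ :=
  deriv (fun s => density j s q) t + inner ℝ (velocity j t q) (∇ (density j t) q)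

/-- `j = (j⁰, J)` is a current vector field on `ℝ × C`. Its values off `ℝ × C` are irrelevant.
Since `j⁰ ≥ 0` on `ℝ × C` by `pos`, the last field says that `j⁰(t, ·)` is integrable on `C`
with integral `1`. -/
structure IsCurrent {d : ℕ} (C : Set (Space d)) (j : ℝ × Space d → ℝ × Space d) : Prop where
  contDiffOn : ContDiffOn ℝ 1 j (univ ×ˢ C)
  div_eq_zero : ∀ t : ℝ, ∀ q ∈ C, divergence j t q = 0
  pos : ∀ t : ℝ, ∀ q ∈ C, j (t, q) ≠ 0 → 0 < density j t q
  normalized : ∀ t : ℝ, ∫⁻ q in C, ENNReal.ofReal (density j t q) = 1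

/-- The measure `μ_t(dq) = j⁰(t, q) dq` on `C`, regarded as a measure on `ℝ^d`. -/
def mu {d : ℕ} (C : Set (Space d)) (j : ℝ × Space d → ℝ × Space d) (t : ℝ) :
    Measure (Space d) :=
  (volume.restrict C).withDensity fun q => ENNReal.ofReal (density j t q)

/-- `Q` restricted to the open interval `I ∋ 0` is a solution of `dQ/dt = J / j⁰` with `Q 0 = q`,
staying in `C` and off the nodes (the zeros of `j`). -/
structure IsSolution {d : ℕ} (C : Set (Space d)) (j : ℝ × Space d → ℝ × Space d)
    (q : Space d) (I : Set ℝ) (Q : ℝ → Space d) : Prop where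
  isOpen : IsOpen I
  ordConnected : I.OrdConnected
  zero_mem : (0 : ℝ) ∈ I
  initial : Q 0 = q
  mem : ∀ t ∈ I, Q t ∈ C
  ne_node : ∀ t ∈ I, j (t, Q t) ≠ 0
  isIntegralCurveOn : IsIntegralCurveOn Q (velocity j) I

open Classical in
/-- The flow map `φ_t`, with `Sum.inr ()` as the cemetery. If `t` lies in the domain of the maximal
solution starting at `q`, that is, in the domain of some solution, then `φ_t(q)` is the value at
`t`, which does not depend on the solution chosen. Otherwise `φ_t(q)` is the cemetery, except that
`φ_0(q) = q` also at the nodes. Points outside `C` are sent to the cemetery. -/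
def flow {d : ℕ} (C : Set (Space d)) (j : ℝ × Space d → ℝ × Space d) (t : ℝ) (q : Space d) :
    Space d ⊕ Unit :=
  if h : ∃ Q : ℝ → Space d, ∃ I : Set ℝ, t ∈ I ∧ IsSolution C j q I Q then Sum.inl (h.choose t)
  else if t = 0 ∧ q ∈ C then Sum.inl q
  else Sum.inr ()

/-- The flowed set `φ_t(B)` without the cemetery. -/
def flowImage {d : ℕ} (C : Set (Space d)) (j : ℝ × Space d → ℝ × Space d) (t : ℝ)
    (B : Set (Space d)) : Set (Space d) :=
  {q | Sum.inl q ∈ flow C j t '' B}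

/-- The distribution `ρ_t = μ_0 ∘ φ_t⁻¹` of the configuration at time `t`. -/
def rho {d : ℕ} (C : Set (Space d)) (j : ℝ × Space d → ℝ × Space d) (t : ℝ) :
    Measure (Space d ⊕ Unit) :=
  (mu C j 0).map (flow C j t)

/-- The family `μ_t` is equivariant on the set of times `I`: `ρ_t = μ_t` for all `t ∈ I`, as
measures on configurations together with the cemetery. -/
def Equivariant {d : ℕ} (C : Set (Space d)) (j : ℝ × Space d → ℝ × Space d) (I : Set ℝ) : Prop :=
  ∀ t ∈ I, rho C j t = (mu C j t).map Sum.inl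

/-- `B` is a bounded Borel subset of `C`. -/
def BoundedBorel {d : ℕ} (C B : Set (Space d)) : Prop :=
  B ⊆ C ∧ Bornology.IsBounded B ∧ MeasurableSet B

/-- Local integrability of the derivative of `j⁰` along the motion, on `[0, T]`. -/
def NodeCondition {d : ℕ} (C : Set (Space d)) (j : ℝ × Space d → ℝ × Space d) (T : ℝ) : Prop :=
  ∀ B : Set (Space d), BoundedBorel C B →
    ∫⁻ t in Icc 0 T, ∫⁻ q in flowImage C j t B, ENNReal.ofReal |materialDeriv j t q| < ⊤

/-- Local integrability of the radial flux `J · q / |q|`, on `[0, T]`. -/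
def InfinityCondition {d : ℕ} (C : Set (Space d)) (j : ℝ × Space d → ℝ × Space d) (T : ℝ) :
    Prop :=
  ∀ B : Set (Space d), BoundedBorel C B →
    ∫⁻ t in Icc 0 T, ∫⁻ q in flowImage C j t B,
      ENNReal.ofReal |inner ℝ (flux j t q) (‖q‖⁻¹ • q)| < ⊤

/-- The radial unit vector towards `S`, minus the gradient of the distance to `S`. -/
def radialVector {d : ℕ} (S : Set (Space d)) (q : Space d) : Space d :=
  -∇ (fun x => Metric.infDist x S) q

/-- Local integrability of `|J · e| / dist(q, S)` in some neighbourhood `S + δ`, on `[0, T]`. -/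
def SingularCondition {d : ℕ} (C : Set (Space d)) (j : ℝ × Space d → ℝ × Space d) (T : ℝ)
    (S : Set (Space d)) : Prop :=
  ∃ δ : ℝ, 0 < δ ∧ ∀ B : Set (Space d), BoundedBorel C B →
    ∫⁻ t in Icc 0 T, ∫⁻ q in flowImage C j t B,
      (Metric.thickening δ S).indicator (fun q =>
        ENNReal.ofReal (|inner ℝ (flux j t q) (radialVector S q)| / Metric.infDist q S)) q < ⊤

end BohmFlow

end

/-! A solution can end before time `T` only by leaving every compact set of regular space-time
points: it runs into nodes, escapes to infinity, or approaches some `S ℓ`. Each possibility has a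
barrier along the trajectory, namely `-log j⁰`, `‖Q‖` and `-log dist(Q, S ℓ)`. Up to sign, the
derivative of the barrier along the motion is the quantity whose absolute value is integrated in
`NodeCondition`, `InfinityCondition` or `SingularCondition`, divided by `j⁰`.

The continuity equation and Jacobi's formula for determinants show that `j⁰(t, φ_t) det Dφ_t` is
constant in time (`exists_hasFDerivAt_sol`). Hence the change of variables `lintegral_image_sol` and
Tonelli turn the hypotheses into finite `μ_0`-expectations over bounded sets of the integrals along
trajectories (`ae_motionIntegral_lt_top`). For almost every starting point these integrals are
finite, the barriers are bounded above, the trajectory stays in a compact regular set, and it lasts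
until `T` (`mem_domain_of_isCompact`).

Equivariance follows by counting mass: the surviving part of `μ_0` is always carried to a measure
below `μ_t`, and if almost everything survives, both have mass one and coincide.

Differentiability of the flow in the initial point comes from Grönwall estimates, after the velocity
is cut off to a compactly supported `C¹` field near one trajectory. -/

noncomputable section

namespace BohmFlow

open Metric Filter Topology NNReal

/-! ### Linear and nonlinear ODEs: differentiable dependence on initial data, Jacobi's formula,
cutoffs. -/

section ODE

/-- The flow of a bounded, globally Lipschitz, time-dependent vector field on `[a, b]`. -/
theorem exists_flow {F : Type*} [NormedAddCommGroup F] [NormedSpace ℝ F] [CompleteSpace F]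
    {f : ℝ → F → F} {K M : ℝ≥0} (hK : ∀ t, LipschitzWith K (f t)) (hM : ∀ t x, ‖f t x‖ ≤ M)
    (hc : ∀ x, Continuous fun t => f t x) {a b : ℝ} (ha : a ≤ 0) (hb : 0 ≤ b) (x₀ : F) (r : ℝ≥0) :
    ∃ Φ : F → ℝ → F, (∀ x ∈ closedBall x₀ r, Φ x 0 = x ∧
      ∀ t ∈ Icc a b, HasDerivWithinAt (Φ x) (f t (Φ x t)) (Icc a b) t) ∧
      ContinuousOn (fun p : F × ℝ => Φ p.1 p.2) (closedBall x₀ r ×ˢ Icc a b) := by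
  obtain ⟨m, hm⟩ : ∃ m : ℝ≥0, (m : ℝ) = max (b - 0) (0 - a) :=
    ⟨_, Real.coe_toNNReal _ (le_max_of_le_left (by simpa))⟩
  have hP : IsPicardLindelof f (tmin := a) (tmax := b) ⟨0, ha, hb⟩ x₀
      (M * m + r) r M K :=
    { lipschitzOnWith := fun t _ => (hK t).lipschitzOnWith
      continuousOn := fun x _ => (hc x).continuousOn
      norm_le := fun t _ x _ => hM t x
      mul_max_le := by
        rw [NNReal.coe_add, NNReal.coe_mul, add_sub_cancel_right, hm] }
  obtain ⟨Φ, h1, h2⟩ := hP.exists_forall_mem_closedBall_eq_hasDerivWithinAt_continuousOn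
  exact ⟨fun x t => Φ (x, t), h1, h2⟩

/-- Linearity in the forcing lets the factor `‖x - q‖` be pulled out of the Grönwall bound in
`hasFDerivAt_flow`. -/
theorem gronwallBound_zero_left (K ε x : ℝ) :
    gronwallBound 0 K ε x = ε * gronwallBound 0 K 1 x := by
  unfold gronwallBound
  split_ifs
  · simp
  · simp only [zero_mul, zero_add]
    ring

variable {E : Type*} [NormedAddCommGroup E] [NormedSpace ℝ E]

/-- The error `Φ x s - Φ q s - Y s (x - q)` starts at zero and solves the variational equation up to
a Taylor remainder. Uniform continuity of `fderiv ℝ w` makes the remainder `o(‖x - q‖)` uniformly in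
`s`, and Grönwall passes this on to the error. -/
theorem hasFDerivAt_flow {w : ℝ × E → E} (hw : ContDiff ℝ 1 w) (hs : HasCompactSupport w)
    {b : ℝ} {q : E} {U : Set E} (hU : U ∈ 𝓝 q) {Φ : E → ℝ → E}
    (hΦ : ∀ x ∈ U, Φ x 0 = x ∧
      ∀ t ∈ Icc 0 b, HasDerivWithinAt (Φ x) (w (t, Φ x t)) (Icc 0 b) t)
    {Y : ℝ → E →L[ℝ] E} (hY₀ : Y 0 = 1)
    (hY : ∀ t ∈ Icc 0 b, HasDerivWithinAt Y
      ((fderiv ℝ w (t, Φ q t) ∘L ContinuousLinearMap.inr ℝ ℝ E) ∘L Y t) (Icc 0 b) t) :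
    ∀ t ∈ Icc 0 b, HasFDerivAt (fun x => Φ x t) (Y t) q := by
  obtain ⟨K, hK⟩ := hw.lipschitzWith_of_hasCompactSupport hs one_ne_zero
  have hKt : ∀ t, LipschitzWith K fun x => w (t, x) := fun t => by
    simpa [Function.comp_def] using hK.comp (LipschitzWith.prodMk_left t)
  set B : ℝ → E → E →L[ℝ] E := fun t x => fderiv ℝ w (t, x) ∘L ContinuousLinearMap.inr ℝ ℝ E
    with hB
  have hBd : ∀ t x, HasFDerivAt (fun x => w (t, x)) (B t x) x := fun t x =>
    ((hw.differentiable one_ne_zero (t, x)).hasFDerivAt).comp x (hasFDerivAt_prodMk_right t x)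
  have hBK : ∀ t x, ‖B t x‖ ≤ K := fun t x => (hBd t x).le_of_lipschitz (hKt t)
  have huc : UniformContinuous (fderiv ℝ w) :=
    (hs.fderiv ℝ).uniformContinuous_of_continuous (hw.continuous_fderiv one_ne_zero)
  have hqU : q ∈ U := mem_of_mem_nhds hU
  intro t ht
  have hb : 0 ≤ b := ht.1.trans ht.2
  set C : ℝ := gronwallBound 0 K 1 b with hC
  have hC0 : 0 ≤ C := by
    have := gronwallBound_mono (le_refl (0 : ℝ)) zero_le_one K.2 hb
    rwa [gronwallBound_x0] at this
  rw [hasFDerivAt_iff_isLittleO, Asymptotics.isLittleO_iff]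
  intro c hc
  -- Chosen so that the final Grönwall bound is `c * ‖x - q‖`; `C + 1` keeps the denominator
  -- positive when `C = 0`.
  set η : ℝ := c / ((C + 1) * Real.exp (K * b)) with hη
  have hη0 : 0 < η := by positivity
  obtain ⟨δ, hδ, hδ'⟩ := Metric.uniformContinuous_iff.1 huc η hη0
  have hlin : ∀ t x y, dist x y < δ → ‖w (t, x) - w (t, y) - B t y (x - y)‖ ≤ η * ‖x - y‖ := by
    intro t x y hxy
    refine (convex_ball y δ).norm_image_sub_le_of_norm_hasFDerivWithin_le'
      (f := fun x => w (t, x)) (f' := fun x => B t x) (fun z _ => (hBd t z).hasFDerivWithinAt)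
      (fun z hz => ?_) (mem_ball_self hδ) hxy
    have h1 : dist ((t, z) : ℝ × E) (t, y) < δ := by simpa [Prod.dist_eq, hδ] using hz
    have h2 := hδ' h1
    rw [dist_eq_norm] at h2
    rw [hB, ← ContinuousLinearMap.sub_comp]
    refine (ContinuousLinearMap.opNorm_comp_le _ _).trans ?_
    refine (mul_le_of_le_one_right (norm_nonneg _) ?_).trans h2.le
    exact ContinuousLinearMap.norm_inr_le_one ℝ ℝ E
  -- Trajectories separate by at most the factor `exp (K * b)`, so those starting in this ball stay
  -- `δ`-close to `Φ q` up to time `b`.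
  have hball : ball q (δ / Real.exp (K * b)) ∈ 𝓝 q := ball_mem_nhds _ (by positivity)
  filter_upwards [hU, hball] with x hx hxq
  have hnh : ∀ s ∈ Ico 0 b, Icc (0 : ℝ) b ∈ 𝓝[≥] s := fun s hs => Icc_mem_nhdsGE_of_mem hs
  have hcx : ∀ x ∈ U, ContinuousOn (Φ x) (Icc 0 b) := fun x hx s hs =>
    ((hΦ x hx).2 s hs).continuousWithinAt
  have hdx : ∀ x ∈ U, ∀ s ∈ Ico 0 b, HasDerivWithinAt (Φ x) (w (s, Φ x s)) (Ici s) s :=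
    fun x hx s hs => ((hΦ x hx).2 s (Ico_subset_Icc_self hs)).mono_of_mem_nhdsWithin (hnh s hs)
  have hdist : ∀ s ∈ Icc 0 b, dist (Φ x s) (Φ q s) ≤ dist x q * Real.exp (K * b) := by
    intro s hs
    refine (dist_le_of_trajectories_ODE (v := fun t x => w (t, x)) hKt (hcx x hx) (hdx x hx)
      (hcx q hqU) (hdx q hqU) (δ := dist x q) ?_ s hs).trans ?_
    · rw [(hΦ x hx).1, (hΦ q hqU).1]
    · have : Real.exp (K * (s - 0)) ≤ Real.exp (K * b) := by
        gcongr
        linarith [hs.2]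
      gcongr
  have hmain := norm_le_gronwallBound_of_norm_deriv_right_le
    (f := fun s => Φ x s - Φ q s - Y s (x - q))
    (f' := fun s => w (s, Φ x s) - w (s, Φ q s) - B s (Φ q s) (Y s (x - q)))
    (δ := 0) (K := K) (ε := η * (‖x - q‖ * Real.exp (K * b))) (a := 0) (b := b)
    (((hcx x hx).sub (hcx q hqU)).sub (fun s hs =>
      (((hY s hs).clm_apply (hasDerivWithinAt_const s _ (x - q)))).continuousWithinAt))
    (fun s hs => by
      have h1 := (hY s (Ico_subset_Icc_self hs)).clm_apply (hasDerivWithinAt_const s _ (x - q))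
      have h2 := h1.mono_of_mem_nhdsWithin (hnh s hs)
      simpa [hB] using ((hdx x hx s hs).fun_sub (hdx q hqU s hs)).fun_sub h2)
    (by simp [(hΦ x hx).1, (hΦ q hqU).1, hY₀])
    (fun s hs => by
      have hs' := Ico_subset_Icc_self hs
      have hd := hdist s hs'
      have hlt : dist (Φ x s) (Φ q s) < δ := by
        refine hd.trans_lt ?_
        rw [mem_ball, lt_div_iff₀ (Real.exp_pos _)] at hxq
        exact hxq
      have h1 := hlin s _ _ hlt
      have h2 : w (s, Φ x s) - w (s, Φ q s) - B s (Φ q s) (Y s (x - q)) =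
          (w (s, Φ x s) - w (s, Φ q s) - B s (Φ q s) (Φ x s - Φ q s)) +
          B s (Φ q s) (Φ x s - Φ q s - Y s (x - q)) := by
        simp only [map_sub]
        abel
      rw [h2]
      refine (norm_add_le _ _).trans ?_
      rw [add_comm]
      refine add_le_add (((B s (Φ q s)).le_opNorm _).trans ?_) (h1.trans ?_)
      · gcongr
        exact hBK _ _
      · rw [dist_eq_norm, dist_eq_norm] at hd
        gcongr) t ht
  rw [sub_zero, gronwallBound_zero_left] at hmain
  have hCt : gronwallBound 0 K 1 t ≤ C := gronwallBound_mono (le_refl _) zero_le_one K.2 ht.2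
  refine hmain.trans ?_
  calc η * (‖x - q‖ * Real.exp (K * b)) * gronwallBound 0 K 1 t
      ≤ η * (‖x - q‖ * Real.exp (K * b)) * (C + 1) := by
        gcongr
        linarith
    _ = c * ‖x - q‖ := by
        rw [hη]
        field_simp

variable [FiniteDimensional ℝ E]

/-- A linear field is not bounded, so it is truncated by a bump function to fit `exists_flow`.
Grönwall, applied to the truncated equation, keeps the solution inside the ball of radius `R` where
the truncation is inactive. -/
theorem exists_linear_flow {A : ℝ → E →L[ℝ] E} {b : ℝ} (hb : 0 ≤ b)
    (hA : ContinuousOn A (Icc 0 b)) :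
    ∃ Y : ℝ → E →L[ℝ] E, Y 0 = 1 ∧
      ∀ t ∈ Icc 0 b, HasDerivWithinAt Y (A t ∘L Y t) (Icc 0 b) t := by
  have : CompleteSpace E := FiniteDimensional.complete ℝ E
  obtain ⟨M₀, hM₀⟩ := isCompact_Icc.exists_bound_of_continuousOn hA
  have h0b : (0 : ℝ) ∈ Icc 0 b := ⟨le_rfl, hb⟩
  have hM₀0 : 0 ≤ M₀ := (norm_nonneg _).trans (hM₀ 0 h0b)
  lift M₀ to ℝ≥0 using hM₀0 with M hM
  set A' : ℝ → E →L[ℝ] E := fun t => A (projIcc 0 b hb t) with hA'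
  have hA'c : Continuous A' :=
    hA.comp_continuous (continuous_subtype_val.comp continuous_projIcc) fun t => (projIcc 0 b hb t).2
  have hA'M : ∀ t, ‖A' t‖ ≤ M := fun t => hM₀ _ (projIcc 0 b hb t).2
  have hA'eq : ∀ t ∈ Icc 0 b, A' t = A t := fun t ht => by simp [hA', projIcc_of_mem hb ht]
  set R : ℝ := ‖(1 : E →L[ℝ] E)‖ * Real.exp (M * b) + 1 with hR
  have hR0 : 0 < R := by positivity
  let χ : ContDiffBump (0 : E →L[ℝ] E) := ⟨R, R + 1, hR0, by linarith⟩
  set g : (E →L[ℝ] E) → (E →L[ℝ] E) := fun Y => χ Y • Y with hg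
  have hgd : ContDiff ℝ 1 g := χ.contDiff.smul contDiff_id
  have hgs : HasCompactSupport g := χ.hasCompactSupport.smul_right
  obtain ⟨C, hC⟩ := hgd.lipschitzWith_of_hasCompactSupport hgs one_ne_zero
  obtain ⟨N, hN⟩ := hgs.exists_bound_of_continuous hgd.continuous
  have hN0 : 0 ≤ N := (norm_nonneg _).trans (hN 0)
  lift N to ℝ≥0 using hN0
  have hgn : ∀ Y, ‖g Y‖ ≤ ‖Y‖ := fun Y => by
    rw [hg, norm_smul, Real.norm_of_nonneg χ.nonneg]
    exact mul_le_of_le_one_left (norm_nonneg _) χ.le_one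
  obtain ⟨Φ, hΦ, -⟩ := exists_flow (f := fun t Y => A' t ∘L g Y) (K := M * C) (M := M * N)
    (fun t => LipschitzWith.of_dist_le_mul fun X Y => by
      rw [dist_eq_norm, ← ContinuousLinearMap.comp_sub]
      refine (ContinuousLinearMap.opNorm_comp_le _ _).trans ?_
      push_cast
      rw [mul_assoc]
      have := hC.dist_le_mul X Y
      rw [dist_eq_norm] at this
      gcongr
      exact hA'M t)
    (fun t Y => by
      refine (ContinuousLinearMap.opNorm_comp_le _ _).trans ?_
      rw [NNReal.coe_mul]
      exact mul_le_mul (hA'M t) (hN Y) (norm_nonneg _) M.2)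
    (fun Y => hA'c.clm_comp continuous_const) le_rfl hb 1 0
  obtain ⟨h0, h1⟩ := hΦ 1 (by simp)
  refine ⟨Φ 1, h0, fun t ht => ?_⟩
  have hbd : ‖Φ 1 t‖ ≤ gronwallBound ‖(1 : E →L[ℝ] E)‖ M 0 (t - 0) := by
    refine norm_le_gronwallBound_of_norm_deriv_right_le (f := Φ 1)
      (fun s hs => (h1 s hs).continuousWithinAt)
      (fun s hs => (h1 s (Ico_subset_Icc_self hs)).mono_of_mem_nhdsWithin
        (Icc_mem_nhdsGE_of_mem hs)) (by rw [h0]) (fun s hs => ?_) t ht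
    rw [add_zero]
    refine (ContinuousLinearMap.opNorm_comp_le _ _).trans ?_
    exact mul_le_mul (hA'M s) (hgn _) (norm_nonneg _) M.2
  have hle : ‖Φ 1 t‖ ≤ R := by
    rw [gronwallBound_ε0, sub_zero] at hbd
    refine hbd.trans ?_
    rw [hR]
    have : Real.exp (M * t) ≤ Real.exp (M * b) := by
      gcongr
      exact ht.2
    nlinarith [norm_nonneg (1 : E →L[ℝ] E)]
  have hχ : χ (Φ 1 t) = 1 := χ.one_of_mem_closedBall (by simpa [χ] using hle)
  have := h1 t ht
  simpa [hg, hχ, hA'eq t ht] using this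

/-- Jacobi's formula. The determinant is multilinear in the rows, and row `i` of `A Y` is a
combination of the rows of `Y`; substituted for row `i` of `Y`, it contributes only `A i i * det Y`.
-/
theorem hasDerivWithinAt_det {Y : ℝ → E →L[ℝ] E} {A : E →L[ℝ] E} {S : Set ℝ} {t : ℝ}
    (h : HasDerivWithinAt Y (A ∘L Y t) S t) :
    HasDerivWithinAt (fun s => (Y s).det) (LinearMap.trace ℝ E A * (Y t).det) S t := by
  classical
  let b := Module.finBasis ℝ E
  let D : ContinuousMultilinearMap ℝ
      (fun _ : Fin (Module.finrank ℝ E) => Fin (Module.finrank ℝ E) → ℝ) ℝ :=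
    { (Matrix.detRowAlternating (R := ℝ) (n := Fin (Module.finrank ℝ E))).toMultilinearMap with
      cont := Continuous.matrix_det continuous_id }
  let m : (E →L[ℝ] E) → Fin (Module.finrank ℝ E) → Fin (Module.finrank ℝ E) → ℝ :=
    fun L => LinearMap.toMatrix b b (L : E →ₗ[ℝ] E)
  have hdet : ∀ L : E →L[ℝ] E, L.det = D (m L) := fun L =>
    (LinearMap.det_toMatrix b (L : E →ₗ[ℝ] E)).symm
  have hm : HasDerivWithinAt (fun s => m (Y s)) (m (A ∘L Y t)) S t := by
    rw [hasDerivWithinAt_pi]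
    intro i
    rw [hasDerivWithinAt_pi]
    intro k
    have h2 := h.clm_apply (hasDerivWithinAt_const t S (b k))
    have h3 := ((b.coord i).toContinuousLinearMap.hasFDerivAt
      (x := Y t (b k))).comp_hasDerivWithinAt t h2
    simpa [m, LinearMap.toMatrix_apply, Function.comp_def] using h3
  have hD := (D.hasFDerivAt (x := m (Y t))).comp_hasDerivWithinAt t hm
  have hmul : m (A ∘L Y t) = (Matrix.of (m A) * Matrix.of (m (Y t)) : Matrix _ _ ℝ) := LinearMap.toMatrix_comp b b b _ _
  convert! hD using 1
  · exact funext fun s => hdet (Y s)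
  · rw [ContinuousMultilinearMap.linearDeriv_apply, hdet, LinearMap.trace_eq_matrix_trace ℝ b,
      Matrix.trace, Finset.sum_mul]
    refine Finset.sum_congr rfl fun i _ => ?_
    have hrow : m (A ∘L Y t) i = ∑ k, m A i k • m (Y t) k := by
      rw [hmul]
      ext l
      simp [Matrix.mul_apply]
    rw [hrow]
    exact (Matrix.det_updateRow_sum (m (Y t)) i (m A i)).symm

/-- A `C¹` vector field on an open set agrees near a given compact subset with a compactly supported
`C¹` vector field on the whole space. -/
theorem exists_cutoff {P F : Type*} [NormedAddCommGroup P] [NormedSpace ℝ P]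
    [FiniteDimensional ℝ P] [NormedAddCommGroup F] [NormedSpace ℝ F] {V : P → F} {G K : Set P}
    (hG : IsOpen G) (hV : ContDiffOn ℝ 1 V G) (hK : IsCompact K) (hKG : K ⊆ G) :
    ∃ w : P → F, ContDiff ℝ 1 w ∧ HasCompactSupport w ∧
      ∃ O, IsOpen O ∧ K ⊆ O ∧ O ⊆ G ∧ EqOn w V O := by
  have : ProperSpace P := FiniteDimensional.proper ℝ P
  obtain ⟨L, hL, hKL, hLG⟩ := exists_compact_between hK hG hKG
  obtain ⟨χ, h1, h0, -⟩ := exists_contMDiffMap_one_nhds_of_subset_interior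
    (n := 1) (modelWithCornersSelf ℝ P) hK.isClosed hKL
  have hχ : ContDiff ℝ 1 χ := χ.contMDiff.contDiff
  have hts : tsupport (fun p => χ p • V p) ⊆ L :=
    closure_minimal (fun p hp => by
      by_contra hpL
      exact hp (by simp [h0 p hpL])) hL.isClosed
  refine ⟨fun p => χ p • V p, ?_, ?_, ?_⟩
  · refine contDiff_iff_contDiffAt.2 fun p => ?_
    -- `V` is smooth only on `G`, but the support of the product lies in `L ⊆ G`, and off the
    -- support the product vanishes locally.
    by_cases hp : p ∈ tsupport fun p => χ p • V p
    · exact hχ.contDiffAt.smul (hV.contDiffAt (hG.mem_nhds (hLG (hts hp))))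
    · exact contDiffAt_const.congr_of_eventuallyEq (notMem_tsupport_iff_eventuallyEq.1 hp)
  · exact hL.of_isClosed_subset (isClosed_tsupport _) hts
  · rw [eventually_nhdsSet_iff_exists] at h1
    obtain ⟨O, hO, hKO, hO1⟩ := h1
    exact ⟨O ∩ G, hO.inter hG, subset_inter hKO hKG, inter_subset_right,
      fun p hp => by simp [hO1 p hp.1]⟩

end ODE

/-! ### The maximal flow: uniqueness, openness of its domain, continuity, non-explosion in compact
sets. -/

section Flow

variable {d : ℕ} {C : Set (Space d)} {j : ℝ × Space d → ℝ × Space d}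

/-- The points of space-time off the nodes. -/
def regular (C : Set (Space d)) (j : ℝ × Space d → ℝ × Space d) : Set (ℝ × Space d) :=
  {p | p.2 ∈ C ∧ j p ≠ 0}

/-- The velocity field on space-time. -/
def spaceTimeVelocity (j : ℝ × Space d → ℝ × Space d) (p : ℝ × Space d) : Space d :=
  velocity j p.1 p.2

/-- The pairs `(t, q)` for which the solution starting at `q` exists up to time `t`. -/
def domain (C : Set (Space d)) (j : ℝ × Space d → ℝ × Space d) : Set (ℝ × Space d) :=
  {p | ∃ Q : ℝ → Space d, ∃ I : Set ℝ, p.1 ∈ I ∧ IsSolution C j p.2 I Q}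

open Classical in
/-- The value at time `t` of the maximal solution starting at `q`, when it exists. -/
def sol (C : Set (Space d)) (j : ℝ × Space d → ℝ × Space d) (t : ℝ) (q : Space d) : Space d :=
  if h : ∃ Q : ℝ → Space d, ∃ I : Set ℝ, t ∈ I ∧ IsSolution C j q I Q then h.choose t else 0

/-- Both definitions pick the same `choose`, so no uniqueness of solutions is involved. -/
theorem flow_eq {t : ℝ} {q : Space d} (h : (t, q) ∈ domain C j) :
    flow C j t q = Sum.inl (sol C j t q) := by
  have h' : ∃ Q : ℝ → Space d, ∃ I : Set ℝ, t ∈ I ∧ IsSolution C j q I Q := h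
  rw [flow, sol, dif_pos h', dif_pos h']

theorem isOpen_regular (hC : IsOpen C) (hj : IsCurrent C j) : IsOpen (regular C j) := by
  have := hj.contDiffOn.continuousOn.isOpen_inter_preimage (isOpen_univ.prod hC)
    (isOpen_compl_singleton (x := (0 : ℝ × Space d)))
  convert! this using 1
  ext p
  simp [regular]

theorem density_pos (hj : IsCurrent C j) {p : ℝ × Space d} (hp : p ∈ regular C j) :
    0 < (j p).1 :=
  hj.pos p.1 p.2 hp.1 hp.2

theorem contDiffAt_current (hC : IsOpen C) (hj : IsCurrent C j) {p : ℝ × Space d}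
    (hp : p ∈ regular C j) : ContDiffAt ℝ 1 j p :=
  hj.contDiffOn.contDiffAt ((isOpen_univ.prod hC).mem_nhds ⟨mem_univ _, hp.1⟩)

theorem contDiffOn_velocity (hC : IsOpen C) (hj : IsCurrent C j) :
    ContDiffOn ℝ 1 (spaceTimeVelocity j) (regular C j) := fun p hp => by
  have h := contDiffAt_current hC hj hp
  exact ((h.fst.inv (density_pos hj hp).ne').smul h.snd).contDiffWithinAt

theorem IsSolution.hasDerivAt {q : Space d} {I : Set ℝ} {Q : ℝ → Space d}
    (h : IsSolution C j q I Q) {t : ℝ} (ht : t ∈ I) :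
    HasDerivAt Q (spaceTimeVelocity j (t, Q t)) t :=
  (h.isIntegralCurveOn t ht).hasDerivAt (h.isOpen.mem_nhds ht)

theorem IsSolution.mem_regular {q : Space d} {I : Set ℝ} {Q : ℝ → Space d}
    (h : IsSolution C j q I Q) {t : ℝ} (ht : t ∈ I) : (t, Q t) ∈ regular C j :=
  ⟨h.mem t ht, h.ne_node t ht⟩

theorem IsSolution.isCompact_graph {q : Space d} {I : Set ℝ} {Q : ℝ → Space d}
    (h : IsSolution C j q I Q) {a b : ℝ} (hab : Icc a b ⊆ I) :
    IsCompact ((fun s => (s, Q s)) '' Icc a b) :=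
  isCompact_Icc.image_of_continuousOn
    (continuousOn_id.prodMk fun _ hs => (h.hasDerivAt (hab hs)).continuousAt.continuousWithinAt)

theorem exists_Ioo_of_isOpen {I : Set ℝ} (hI : IsOpen I) (hI' : I.OrdConnected) {x y : ℝ}
    (hx : x ∈ I) (hy : y ∈ I) : ∃ a b, x ∈ Ioo a b ∧ y ∈ Ioo a b ∧ Icc a b ⊆ I := by
  have hm : min x y ∈ I := by rcases min_choice x y with h | h <;> rwa [h]
  have hM : max x y ∈ I := by rcases max_choice x y with h | h <;> rwa [h]
  obtain ⟨a, ha, haI⟩ := exists_Ioc_subset_of_mem_nhds (hI.mem_nhds hm) (exists_lt _)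
  obtain ⟨b, hb, hbI⟩ := exists_Ico_subset_of_mem_nhds (hI.mem_nhds hM) (exists_gt _)
  obtain ⟨a', ha'⟩ := exists_between ha
  obtain ⟨b', hb'⟩ := exists_between hb
  refine ⟨a', b', ⟨ha'.2.trans_le (min_le_left _ _), (le_max_left _ _).trans_lt hb'.1⟩,
    ⟨ha'.2.trans_le (min_le_right _ _), (le_max_right _ _).trans_lt hb'.1⟩, ?_⟩
  exact hI'.out (haI ⟨ha'.1, ha'.2.le⟩) (hbI ⟨hb'.1.le, hb'.2⟩)

theorem lipschitzWith_slice {w : ℝ × Space d → Space d} {K : ℝ≥0} (hK : LipschitzWith K w)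
    (t : ℝ) : LipschitzWith K fun x => w (t, x) := by
  simpa [Function.comp_def] using hK.comp (LipschitzWith.prodMk_left t)

/-- On a compact interval containing both times, the two graphs form a compact set of regular
points. There the velocity agrees with a globally Lipschitz field, to which ODE uniqueness applies.
-/
theorem IsSolution.eq_of_eq (hC : IsOpen C) (hj : IsCurrent C j) {q₁ q₂ : Space d}
    {I₁ I₂ : Set ℝ} {Q₁ Q₂ : ℝ → Space d} (h₁ : IsSolution C j q₁ I₁ Q₁)
    (h₂ : IsSolution C j q₂ I₂ Q₂) {t₀ t : ℝ} (ht₀ : t₀ ∈ I₁ ∩ I₂) (ht : t ∈ I₁ ∩ I₂)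
    (heq : Q₁ t₀ = Q₂ t₀) : Q₁ t = Q₂ t := by
  obtain ⟨a, b, hta, htb, hab⟩ := exists_Ioo_of_isOpen (h₁.isOpen.inter h₂.isOpen)
    (h₁.ordConnected.inter h₂.ordConnected) ht₀ ht
  have hab₁ : Icc a b ⊆ I₁ := hab.trans inter_subset_left
  have hab₂ : Icc a b ⊆ I₂ := hab.trans inter_subset_right
  obtain ⟨w, hw, hws, O, -, hO, -, hwO⟩ := exists_cutoff (isOpen_regular hC hj)
    (contDiffOn_velocity hC hj) ((h₁.isCompact_graph hab₁).union (h₂.isCompact_graph hab₂)) (by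
      rintro p (⟨s, hs, rfl⟩ | ⟨s, hs, rfl⟩)
      · exact h₁.mem_regular (hab₁ hs)
      · exact h₂.mem_regular (hab₂ hs))
  obtain ⟨K, hK⟩ := hw.lipschitzWith_of_hasCompactSupport hws one_ne_zero
  refine ODE_solution_unique_of_mem_Ioo (v := fun t x => w (t, x)) (s := fun _ => univ)
    (fun t _ => (lipschitzWith_slice hK t).lipschitzOnWith) hta (fun s hs => ⟨?_, mem_univ _⟩)
    (fun s hs => ⟨?_, mem_univ _⟩) heq htb
  · have hs' := Ioo_subset_Icc_self hs
    rw [hwO (hO (Or.inl ⟨s, hs', rfl⟩))]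
    exact h₁.hasDerivAt (hab₁ hs')
  · have hs' := Ioo_subset_Icc_self hs
    rw [hwO (hO (Or.inr ⟨s, hs', rfl⟩))]
    exact h₂.hasDerivAt (hab₂ hs')

theorem IsSolution.mem_domain {q : Space d} {I : Set ℝ} {Q : ℝ → Space d}
    (h : IsSolution C j q I Q) {t : ℝ} (ht : t ∈ I) : (t, q) ∈ domain C j :=
  ⟨Q, I, ht, h⟩

theorem IsSolution.sol_eq (hC : IsOpen C) (hj : IsCurrent C j) {q : Space d} {I : Set ℝ}
    {Q : ℝ → Space d} (h : IsSolution C j q I Q) {t : ℝ} (ht : t ∈ I) : sol C j t q = Q t := by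
  have h' : ∃ Q : ℝ → Space d, ∃ I : Set ℝ, t ∈ I ∧ IsSolution C j q I Q := ⟨Q, I, ht, h⟩
  rw [sol, dif_pos h']
  obtain ⟨I', ht', hI'⟩ := h'.choose_spec
  exact hI'.eq_of_eq hC hj h ⟨hI'.zero_mem, h.zero_mem⟩ ⟨ht', ht⟩ (by rw [hI'.initial, h.initial])

/-- The maximal solution. -/
theorem isSolution_sol (hC : IsOpen C) (hj : IsCurrent C j) {q : Space d}
    (h0 : (0, q) ∈ domain C j) :
    IsSolution C j q {t | (t, q) ∈ domain C j} fun t => sol C j t q where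
  isOpen := isOpen_iff_mem_nhds.2 fun t ⟨_, _, ht, hQ⟩ =>
    mem_of_superset (hQ.isOpen.mem_nhds ht) fun _ hs => hQ.mem_domain hs
  ordConnected := ⟨fun s ⟨_, _, hs, hQ⟩ t ⟨_, _, ht, hR⟩ x hx => by
    rcases le_total x 0 with h | h
    · exact hQ.mem_domain (hQ.ordConnected.out hs hQ.zero_mem ⟨hx.1, h⟩)
    · exact hR.mem_domain (hR.ordConnected.out hR.zero_mem ht ⟨h, hx.2⟩)⟩
  zero_mem := h0
  initial := by
    obtain ⟨Q, I, ht, hQ⟩ := h0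
    exact (hQ.sol_eq hC hj ht).trans hQ.initial
  mem := fun t ⟨_, _, ht, hQ⟩ => by
    rw [hQ.sol_eq hC hj ht]
    exact hQ.mem t ht
  ne_node := fun t ⟨_, _, ht, hQ⟩ => by
    rw [hQ.sol_eq hC hj ht]
    exact hQ.ne_node t ht
  isIntegralCurveOn := fun t ⟨_, I, ht, hQ⟩ => by
    have hev : (fun t => sol C j t q) =ᶠ[𝓝 t] _ :=
      mem_of_superset (hQ.isOpen.mem_nhds ht) fun s hs => hQ.sol_eq hC hj hs
    have heq : sol C j t q = _ := hQ.sol_eq hC hj ht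
    beta_reduce
    rw [heq]
    exact ((hQ.hasDerivAt ht).congr_of_eventuallyEq hev).hasDerivWithinAt

theorem sol_mem_regular (hC : IsOpen C) (hj : IsCurrent C j) {t : ℝ} {q : Space d}
    (h : (t, q) ∈ domain C j) : (t, sol C j t q) ∈ regular C j := by
  obtain ⟨Q, I, ht, hQ⟩ := h
  rw [hQ.sol_eq hC hj ht]
  exact hQ.mem_regular ht

theorem zero_mem_domain {t : ℝ} {q : Space d} (h : (t, q) ∈ domain C j) : (0, q) ∈ domain C j := by
  obtain ⟨Q, I, -, hQ⟩ := h
  exact hQ.mem_domain hQ.zero_mem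

theorem mem_domain_of_le {s t : ℝ} {q : Space d} (h : (t, q) ∈ domain C j) (hs : 0 ≤ s)
    (hst : s ≤ t) : (s, q) ∈ domain C j := by
  obtain ⟨Q, I, ht, hQ⟩ := h
  exact hQ.mem_domain (hQ.ordConnected.out hQ.zero_mem ht ⟨hs, hst⟩)

theorem sol_injOn (hC : IsOpen C) (hj : IsCurrent C j) (t : ℝ) :
    InjOn (sol C j t) {q | (t, q) ∈ domain C j} := by
  rintro q₁ ⟨Q₁, I₁, ht₁, h₁⟩ q₂ ⟨Q₂, I₂, ht₂, h₂⟩ heq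
  rw [h₁.sol_eq hC hj ht₁, h₂.sol_eq hC hj ht₂] at heq
  have := h₁.eq_of_eq hC hj h₂ ⟨ht₁, ht₂⟩ ⟨h₁.zero_mem, h₂.zero_mem⟩ heq
  rwa [h₁.initial, h₂.initial] at this

/-- A solution of a modified equation solves the original one as long as it stays where the two
vector fields agree. -/
theorem exists_isSolution_of_curve {w : ℝ × Space d → Space d} {O : Set (ℝ × Space d)}
    (hO : IsOpen O) (hOr : O ⊆ regular C j) (hwO : EqOn w (spaceTimeVelocity j) O)
    {α : ℝ → Space d} {a b s : ℝ}
    (hα : ∀ t ∈ Icc a b, HasDerivWithinAt α (w (t, α t)) (Icc a b) t) (h0 : 0 ∈ Ioo a b)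
    (hs : s ∈ Ioo a b) (hmem : ∀ r ∈ uIcc 0 s, (r, α r) ∈ O) :
    ∃ I, s ∈ I ∧ IsSolution C j (α 0) I α := by
  have hα' : ∀ t ∈ Ioo a b, HasDerivAt α (w (t, α t)) t := fun t ht =>
    (hα t (Ioo_subset_Icc_self ht)).hasDerivAt (Icc_mem_nhds ht.1 ht.2)
  set W : Set ℝ := Ioo a b ∩ (fun r => (r, α r)) ⁻¹' O with hW
  have hWo : IsOpen W := ContinuousOn.isOpen_inter_preimage
    (continuousOn_id.prodMk fun t ht => (hα' t ht).continuousAt.continuousWithinAt) isOpen_Ioo hO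
  have hsub : uIcc 0 s ⊆ W := fun r hr => ⟨ordConnected_Ioo.uIcc_subset h0 hs hr, hmem r hr⟩
  have hcW := connectedComponentIn_subset W 0
  -- The component of `0` in the open set `W` is an open interval, and it reaches `s` because `uIcc
  -- 0 s` is connected and lies in `W`.
  refine ⟨connectedComponentIn W 0,
    isPreconnected_uIcc.subset_connectedComponentIn left_mem_uIcc hsub right_mem_uIcc,
    hWo.connectedComponentIn, isPreconnected_connectedComponentIn.ordConnected,
    mem_connectedComponentIn (hsub left_mem_uIcc), rfl, fun t ht => (hOr (hcW ht).2).1,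
    fun t ht => (hOr (hcW ht).2).2, fun t ht => ?_⟩
  have h1 := hα' t (hcW ht).1
  rw [hwO (hcW ht).2] at h1
  exact h1.hasDerivWithinAt

theorem exists_flow_of_hasCompactSupport {w : ℝ × Space d → Space d} (hw : ContDiff ℝ 1 w)
    (hws : HasCompactSupport w) {a b : ℝ} (ha : a ≤ 0) (hb : 0 ≤ b) (q : Space d) :
    ∃ Φ : Space d → ℝ → Space d, (∀ x ∈ closedBall q 1, Φ x 0 = x ∧
      ∀ t ∈ Icc a b, HasDerivWithinAt (Φ x) (w (t, Φ x t)) (Icc a b) t) ∧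
      ContinuousOn (fun p : Space d × ℝ => Φ p.1 p.2) (closedBall q 1 ×ˢ Icc a b) := by
  obtain ⟨K, hK⟩ := hw.lipschitzWith_of_hasCompactSupport hws one_ne_zero
  obtain ⟨M, hM⟩ := hws.exists_bound_of_continuous hw.continuous
  have hM0 : 0 ≤ M := (norm_nonneg _).trans (hM 0)
  lift M to ℝ≥0 using hM0
  simpa using exists_flow (f := fun t x => w (t, x)) (lipschitzWith_slice hK) (fun t x => hM (t, x))
    (fun x => hw.continuous.comp (by fun_prop)) ha hb q 1

theorem zero_mem_domain_of_mem_regular (hC : IsOpen C) (hj : IsCurrent C j) {q : Space d}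
    (hq : (0, q) ∈ regular C j) : (0, q) ∈ domain C j := by
  obtain ⟨w, hw, hws, O, hO, hqO, hOr, hwO⟩ := exists_cutoff (isOpen_regular hC hj)
    (contDiffOn_velocity hC hj) isCompact_singleton (singleton_subset_iff.2 hq)
  obtain ⟨Φ, hΦ, -⟩ := exists_flow_of_hasCompactSupport hw hws (a := -1) (b := 1) (by norm_num)
    (by norm_num) q
  obtain ⟨h0, h1⟩ := hΦ q (mem_closedBall_self zero_le_one)
  have h01 : (0 : ℝ) ∈ Ioo (-1) 1 := by norm_num
  obtain ⟨I, hI, hs⟩ := exists_isSolution_of_curve hO hOr hwO h1 h01 h01 (fun r hr => by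
    rw [uIcc_self, mem_singleton_iff] at hr
    rw [hr, h0]
    exact hqO rfl)
  rw [h0] at hs
  exact hs.mem_domain hI

/-- Near a solution, all solutions are given by the flow of a compactly supported vector field. -/
theorem exists_local_flow (hC : IsOpen C) (hj : IsCurrent C j) {t : ℝ} {q : Space d}
    (h : (t, q) ∈ domain C j) :
    ∃ w : ℝ × Space d → Space d, ContDiff ℝ 1 w ∧ HasCompactSupport w ∧
      ∃ a b, 0 ∈ Ioo a b ∧ t ∈ Ioo a b ∧ ∃ U ∈ 𝓝 q, ∃ Φ : Space d → ℝ → Space d,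
      (∀ x ∈ U, Φ x 0 = x ∧
        (∀ s ∈ Icc a b, HasDerivWithinAt (Φ x) (w (s, Φ x s)) (Icc a b) s) ∧
        (∀ s ∈ Icc a b, (s, Φ x s) ∈ regular C j ∧
          w =ᶠ[𝓝 (s, Φ x s)] spaceTimeVelocity j) ∧
        ∀ s ∈ Ioo a b, (s, x) ∈ domain C j ∧ sol C j s x = Φ x s) ∧
      ContinuousOn (fun p : Space d × ℝ => Φ p.1 p.2) (U ×ˢ Icc a b) := by
  obtain ⟨Q, I, ht, hQ⟩ := h
  obtain ⟨a, b, h0, hta, hab⟩ := exists_Ioo_of_isOpen hQ.isOpen hQ.ordConnected hQ.zero_mem ht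
  obtain ⟨w, hw, hws, O, hO, hKO, hOr, hwO⟩ := exists_cutoff (isOpen_regular hC hj)
    (contDiffOn_velocity hC hj) (hQ.isCompact_graph hab) (by
      rintro p ⟨s, hs, rfl⟩
      exact hQ.mem_regular (hab hs))
  obtain ⟨Φ, hΦ, hΦc⟩ := exists_flow_of_hasCompactSupport hw hws h0.1.le h0.2.le q
  obtain ⟨K, hK⟩ := hw.lipschitzWith_of_hasCompactSupport hws one_ne_zero
  obtain ⟨hq0, hq1⟩ := hΦ q (mem_closedBall_self zero_le_one)
  have hΦQ : EqOn (Φ q) Q (Icc a b) := by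
    refine ODE_solution_unique_of_mem_Icc (v := fun t x => w (t, x)) (s := fun _ => univ)
      (fun t _ => (lipschitzWith_slice hK t).lipschitzOnWith) h0
      (fun s hs => (hq1 s hs).continuousWithinAt)
      (fun s hs => (hq1 s (Ioo_subset_Icc_self hs)).hasDerivAt (Icc_mem_nhds hs.1 hs.2))
      (fun _ _ => mem_univ _)
      (fun s hs => (hQ.hasDerivAt (hab hs)).continuousAt.continuousWithinAt)
      (fun s hs => ?_) (fun _ _ => mem_univ _) (by rw [hq0, hQ.initial])
    have hs' := Ioo_subset_Icc_self hs
    rw [hwO (hKO ⟨s, hs', rfl⟩)]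
    exact hQ.hasDerivAt (hab hs')
  -- Tube argument: since `Icc a b` is compact, trajectories from a whole neighbourhood of `q` stay
  -- in `O` throughout.
  have hev : ∀ᶠ x in 𝓝 q, ∀ s ∈ Icc a b, x ∈ closedBall q 1 → s ∈ Icc a b → (s, Φ x s) ∈ O := by
    refine isCompact_Icc.eventually_forall_of_forall_eventually fun s hs => ?_
    have hc : ContinuousWithinAt (fun p : Space d × ℝ => (p.2, Φ p.1 p.2))
        (closedBall q 1 ×ˢ Icc a b) (q, s) :=
      continuousWithinAt_snd.prodMk (hΦc (q, s) ⟨mem_closedBall_self zero_le_one, hs⟩)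
    have hqs : (s, Φ q s) ∈ O := by
      rw [hΦQ hs]
      exact hKO ⟨s, hs, rfl⟩
    have := hc.eventually (hO.mem_nhds hqs)
    rw [eventually_nhdsWithin_iff] at this
    filter_upwards [this] with p hp h1 h2 using hp ⟨h1, h2⟩
  set U : Set (Space d) := closedBall q 1 ∩
    {x | ∀ s ∈ Icc a b, x ∈ closedBall q 1 → s ∈ Icc a b → (s, Φ x s) ∈ O} with hU
  have hUO : ∀ x ∈ U, ∀ s ∈ Icc a b, (s, Φ x s) ∈ O := fun x hx s hs => hx.2 s hs hx.1 hs
  refine ⟨w, hw, hws, a, b, h0, hta, U,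
    inter_mem (closedBall_mem_nhds q zero_lt_one) hev, Φ, fun x hx => ?_,
    hΦc.mono (prod_mono inter_subset_left Subset.rfl)⟩
  obtain ⟨hx0, hx1⟩ := hΦ x hx.1
  refine ⟨hx0, hx1, fun s hs => ⟨hOr (hUO x hx s hs), ?_⟩, fun s hs => ?_⟩
  · exact hwO.eventuallyEq_of_mem (hO.mem_nhds (hUO x hx s hs))
  · obtain ⟨I', hsI', hI'⟩ := exists_isSolution_of_curve hO hOr hwO hx1 h0 hs
      fun r hr => hUO x hx r (Ioo_subset_Icc_self (ordConnected_Ioo.uIcc_subset h0 hs hr))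
    rw [hx0] at hI'
    exact ⟨hI'.mem_domain hsI', hI'.sol_eq hC hj hsI'⟩

theorem isOpen_domain (hC : IsOpen C) (hj : IsCurrent C j) : IsOpen (domain C j) := by
  refine isOpen_iff_mem_nhds.2 fun ⟨t, q⟩ h => ?_
  obtain ⟨w, -, -, a, b, -, ht, U, hU, Φ, hΦ, -⟩ := exists_local_flow hC hj h
  exact mem_of_superset (prod_mem_nhds (Ioo_mem_nhds ht.1 ht.2) hU)
    fun p hp => ((hΦ p.2 hp.2).2.2.2 p.1 hp.1).1

theorem continuousOn_sol (hC : IsOpen C) (hj : IsCurrent C j) :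
    ContinuousOn (fun p : ℝ × Space d => sol C j p.1 p.2) (domain C j) := by
  intro ⟨t, q⟩ h
  obtain ⟨w, -, -, a, b, -, ht, U, hU, Φ, hΦ, hc⟩ := exists_local_flow hC hj h
  have hn : Ioo a b ×ˢ U ∈ 𝓝 (t, q) := prod_mem_nhds (Ioo_mem_nhds ht.1 ht.2) hU
  have hn' : U ×ˢ Icc a b ∈ 𝓝 (q, t) := prod_mem_nhds hU (Icc_mem_nhds ht.1 ht.2)
  have h1 : ContinuousAt (fun p : ℝ × Space d => Φ p.2 p.1) (t, q) :=
    ContinuousAt.comp (f := Prod.swap) (x := (t, q)) (hc.continuousAt hn')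
      continuous_swap.continuousAt
  exact (h1.congr (mem_of_superset hn fun p hp =>
    ((hΦ p.2 hp.2).2.2.2 p.1 hp.1).2.symm)).continuousWithinAt

/-- A solution that stays in a compact set of regular points does not explode. -/
theorem mem_domain_of_isCompact (hC : IsOpen C) (hj : IsCurrent C j) {q : Space d}
    (h0 : (0, q) ∈ domain C j) {T : ℝ} (hT : 0 ≤ T) {K : Set (ℝ × Space d)} (hK : IsCompact K)
    (hKr : K ⊆ regular C j)
    (hmem : ∀ t ∈ Icc 0 T, (t, q) ∈ domain C j → (t, sol C j t q) ∈ K) :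
    (T, q) ∈ domain C j := by
  obtain ⟨w, hw, hws, O, hO, hKO, hOr, hwO⟩ := exists_cutoff (isOpen_regular hC hj)
    (contDiffOn_velocity hC hj) hK hKr
  obtain ⟨Φ, hΦ, -⟩ := exists_flow_of_hasCompactSupport hw hws (a := -1) (b := T + 1) (by norm_num)
    (by linarith) q
  obtain ⟨hq0, hq1⟩ := hΦ q (mem_closedBall_self zero_le_one)
  have h0' : (0 : ℝ) ∈ Ioo (-1) (T + 1) := ⟨by norm_num, by linarith⟩
  have hT' : ∀ t ∈ Icc 0 T, t ∈ Ioo (-1) (T + 1) := fun t ht =>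
    ⟨by linarith [ht.1], by linarith [ht.2]⟩
  have key : ∀ t ∈ Icc 0 T, (∀ r ∈ Icc 0 t, (r, Φ q r) ∈ O) →
      (t, q) ∈ domain C j ∧ sol C j t q = Φ q t := fun t ht hr => by
    obtain ⟨I, htI, hI⟩ := exists_isSolution_of_curve hO hOr hwO hq1 h0' (hT' t ht)
      (by rwa [uIcc_of_le ht.1])
    rw [hq0] at hI
    exact ⟨hI.mem_domain htI, hI.sol_eq hC hj htI⟩
  suffices hall : ∀ t ∈ Icc 0 T, (t, Φ q t) ∈ O from (key T ⟨hT, le_rfl⟩ hall).1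
  by_contra! hcon
  have hcont : ContinuousOn (fun t => (t, Φ q t)) (Icc 0 T) := continuousOn_id.prodMk fun t ht =>
    ((hq1 t (Ioo_subset_Icc_self (hT' t ht))).mono (Icc_subset_Icc (by norm_num)
      (by linarith))).continuousWithinAt
  -- The least element `t₁` of `N` is the first exit time from `O`. Before `t₁` the curve is the
  -- true solution, hence in `K`; closedness puts it in `K ⊆ O` at `t₁` too, a contradiction.
  set N : Set ℝ := Icc 0 T ∩ (fun t => (t, Φ q t)) ⁻¹' Oᶜ with hN
  have hNc : IsCompact N := isCompact_Icc.of_isClosed_subset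
    (hcont.preimage_isClosed_of_isClosed isClosed_Icc hO.isClosed_compl) inter_subset_left
  obtain ⟨t₁, ⟨ht₁, ht₁O⟩, hmin⟩ := hNc.exists_isLeast
    (by obtain ⟨t, ht, htO⟩ := hcon; exact ⟨t, ht, htO⟩)
  have hlt : ∀ t ∈ Icc 0 T, t < t₁ → (t, Φ q t) ∈ O := fun t ht htt => by
    by_contra hn
    exact htt.not_ge (hmin ⟨ht, hn⟩)
  have hltK : ∀ t ∈ Icc 0 T, t < t₁ → (t, Φ q t) ∈ K := fun t ht htt => by
    obtain ⟨h1, h2⟩ := key t ht fun r hr => hlt r ⟨hr.1, hr.2.trans ht.2⟩ (hr.2.trans_lt htt)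
    rw [← h2]
    exact hmem t ht h1
  refine ht₁O (hKO ?_)
  rcases ht₁.1.eq_or_lt with h | h
  · have h2 := hmem 0 ⟨le_rfl, hT⟩ h0
    rw [(isSolution_sol hC hj h0).initial] at h2
    simpa [← h, hq0] using h2
  · have hsub : Ico 0 t₁ ⊆ Icc 0 T := fun r hr => ⟨hr.1, hr.2.le.trans ht₁.2⟩
    have hcl : t₁ ∈ closure (Ico 0 t₁) := by
      rw [closure_Ico h.ne]
      exact ⟨h.le, le_rfl⟩
    have h3 := ((hcont t₁ ht₁).mono hsub).mem_closure_image hcl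
    exact closure_minimal (by rintro _ ⟨r, hr, rfl⟩; exact hltK r (hsub hr) hr.2) hK.isClosed h3

end Flow

/-! ### Transport of the density by the Jacobian of the flow. -/

section Liouville

variable {d : ℕ} {C : Set (Space d)} {j : ℝ × Space d → ℝ × Space d}

theorem hasFDerivAt_slice {p : ℝ × Space d} (hd : DifferentiableAt ℝ j p) :
    HasFDerivAt (fun x => j (p.1, x))
      (fderiv ℝ j p ∘L ContinuousLinearMap.inr ℝ ℝ (Space d)) p.2 :=
  HasFDerivAt.comp p.2 (f := fun x => (p.1, x)) (g := j) hd.hasFDerivAt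
    (hasFDerivAt_prodMk_right p.1 p.2)

theorem deriv_density {p : ℝ × Space d} (hd : DifferentiableAt ℝ j p) :
    deriv (fun s => density j s p.2) p.1 = (fderiv ℝ j p (1, 0)).1 := by
  have h1 : HasDerivAt (fun s : ℝ => (s, p.2)) ((1 : ℝ), (0 : Space d)) p.1 :=
    (hasDerivAt_id _).prodMk (hasDerivAt_const _ _)
  have h2 := HasFDerivAt.comp_hasDerivAt (f := fun s : ℝ => (s, p.2)) p.1
    (hd.hasFDerivAt.fst) h1
  exact h2.deriv

theorem divergence_eq {p : ℝ × Space d} (hd : DifferentiableAt ℝ j p) :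
    divergence j p.1 p.2 = (fderiv ℝ j p (1, 0)).1 +
      ∑ i : Fin d, (fderiv ℝ j p (0, EuclideanSpace.single i 1)).2 i := by
  rw [divergence, deriv_density hd]
  congr 1
  refine Finset.sum_congr rfl fun i _ => ?_
  have h1 := (EuclideanSpace.proj i : Space d →L[ℝ] ℝ).hasFDerivAt.comp p.2
    (hasFDerivAt_slice hd).snd
  have h2 : fderiv ℝ (fun x => flux j p.1 x i) p.2 = _ := h1.fderiv
  rw [h2]
  simp

theorem materialDeriv_eq {p : ℝ × Space d} (hd : DifferentiableAt ℝ j p) :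
    materialDeriv j p.1 p.2 = (fderiv ℝ j p (1, spaceTimeVelocity j p)).1 := by
  have h1 : fderiv ℝ (density j p.1) p.2 = _ := (hasFDerivAt_slice hd).fst.fderiv
  have h2 : ((1 : ℝ), spaceTimeVelocity j p) = (1, 0) + (0, spaceTimeVelocity j p) := by simp
  rw [materialDeriv, deriv_density hd, real_inner_comm, gradient, InnerProductSpace.toDual_symm_apply,
    h1, h2, map_add, Prod.fst_add]
  rfl

/-- The continuity equation in Lagrangian form, `j⁰ div v = -(∂_t + v · ∇) j⁰`, by the product rule
for `v = J / j⁰`. -/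
theorem density_mul_trace (hC : IsOpen C) (hj : IsCurrent C j) {p : ℝ × Space d}
    (hp : p ∈ regular C j) :
    (j p).1 * LinearMap.trace ℝ (Space d)
      (fderiv ℝ (spaceTimeVelocity j) p ∘L ContinuousLinearMap.inr ℝ ℝ (Space d)) =
      -(fderiv ℝ j p (1, spaceTimeVelocity j p)).1 := by
  have hd : DifferentiableAt ℝ j p := (contDiffAt_current hC hj hp).differentiableAt one_ne_zero
  have hne : (j p).1 ≠ 0 := (density_pos hj hp).ne'
  have hv : HasFDerivAt (spaceTimeVelocity j) _ p :=
    ((hasDerivAt_inv hne).comp_hasFDerivAt p hd.hasFDerivAt.fst).smul hd.hasFDerivAt.snd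
  have hdiv := hj.div_eq_zero p.1 p.2 hp.1
  rw [divergence_eq hd] at hdiv
  have hJ : ∑ i : Fin d, (j p).2 i • ((0 : ℝ), EuclideanSpace.single i (1 : ℝ)) = (0, (j p).2) := by
    ext i
    · simp [Prod.fst_sum]
    · simp [Prod.snd_sum, Pi.single_apply]
  have hsum : ∑ i : Fin d, (j p).2 i * (fderiv ℝ j p (0, EuclideanSpace.single i 1)).1 =
      (fderiv ℝ j p (0, (j p).2)).1 := by
    rw [← hJ, map_sum, Prod.fst_sum]
    simp only [map_smul, Prod.smul_fst, smul_eq_mul]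
  have hvel : ((1 : ℝ), spaceTimeVelocity j p) = (1, 0) + (j p).1⁻¹ • (0, (j p).2) := by
    simp [spaceTimeVelocity, velocity, density, flux]
  rw [hvel, map_add, map_smul, Prod.fst_add, Prod.smul_fst, ← hsum,
    LinearMap.trace_eq_sum_inner _ (EuclideanSpace.basisFun (Fin d) ℝ), hv.fderiv]
  have hterm : ∀ i : Fin d, (j p).1 * inner ℝ (EuclideanSpace.basisFun (Fin d) ℝ i)
      (((((j p).1⁻¹ • (ContinuousLinearMap.snd ℝ ℝ (Space d)).comp (fderiv ℝ j p) +
        ((-((j p).1 ^ 2)⁻¹) • (ContinuousLinearMap.fst ℝ ℝ (Space d)).comp (fderiv ℝ j p)).smulRight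
          (j p).2) ∘L ContinuousLinearMap.inr ℝ ℝ (Space d) : Space d →L[ℝ] Space d) :
          Space d →ₗ[ℝ] Space d) (EuclideanSpace.basisFun (Fin d) ℝ i)) =
      (fderiv ℝ j p (0, EuclideanSpace.single i 1)).2 i -
        (j p).1⁻¹ * ((j p).2 i * (fderiv ℝ j p (0, EuclideanSpace.single i 1)).1) := by
    intro i
    simp [EuclideanSpace.inner_single_left]
    field_simp
    ring
  rw [Finset.mul_sum]
  refine (Finset.sum_congr rfl fun i _ => hterm i).trans ?_
  rw [Finset.sum_sub_distrib, ← Finset.mul_sum, smul_eq_mul]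
  linarith

/-- The flow is differentiable in the initial point, and transports the density. -/
theorem exists_hasFDerivAt_sol (hC : IsOpen C) (hj : IsCurrent C j) {t : ℝ} (ht : 0 ≤ t)
    {q : Space d} (h : (t, q) ∈ domain C j) :
    ∃ Y : Space d →L[ℝ] Space d, HasFDerivAt (sol C j t) Y q ∧
      density j t (sol C j t q) * Y.det = density j 0 q := by
  obtain ⟨w, hw, hws, a, b, h0, htab, U, hU, Φ, hΦ, -⟩ := exists_local_flow hC hj h
  have hq := hΦ q (mem_of_mem_nhds hU)
  have hsub : Icc 0 b ⊆ Icc a b := Icc_subset_Icc_left h0.1.le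
  have hcurve : ∀ s ∈ Icc 0 b, HasDerivWithinAt (fun s => (s, Φ q s))
      ((1 : ℝ), w (s, Φ q s)) (Icc 0 b) s := fun s hs =>
    (hasDerivWithinAt_id _ _).prodMk ((hq.2.1 s (hsub hs)).mono hsub)
  have hcont : ContinuousOn (fun s => (s, Φ q s)) (Icc 0 b) := fun s hs =>
    (hcurve s hs).continuousWithinAt
  obtain ⟨Y, hY0, hY⟩ := exists_linear_flow
    (A := fun s => fderiv ℝ w (s, Φ q s) ∘L ContinuousLinearMap.inr ℝ ℝ (Space d)) h0.2.le
    (((hw.continuous_fderiv one_ne_zero).comp_continuousOn hcont).clm_comp continuousOn_const)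
  have htb : t ∈ Icc 0 b := ⟨ht, htab.2.le⟩
  have hder := hasFDerivAt_flow hw hws (b := b) hU
    (fun x hx => ⟨(hΦ x hx).1, fun s hs => ((hΦ x hx).2.1 s (hsub hs)).mono hsub⟩) hY0 hY t htb
  refine ⟨Y t, hder.congr_of_eventuallyEq
    (mem_of_superset hU fun x hx => ((hΦ x hx).2.2.2 t htab).2), ?_⟩
  rw [(hq.2.2.2 t htab).2]
  -- By Jacobi's formula the derivative is the material derivative of `j⁰` plus `j⁰ div v`, times
  -- `det Y`; `density_mul_trace` makes the sum vanish.
  have hdF : ∀ s ∈ Icc 0 b, HasDerivWithinAt (fun s => (j (s, Φ q s)).1 * (Y s).det) 0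
      (Icc 0 b) s := fun s hs => by
    obtain ⟨hreg, hweq⟩ := hq.2.2.1 s (hsub hs)
    have hd := (contDiffAt_current hC hj hreg).differentiableAt one_ne_zero
    have h1 := hd.hasFDerivAt.fst.comp_hasDerivWithinAt s (hcurve s hs)
    have h2 := h1.mul (hasDerivWithinAt_det (hY s hs))
    have h3 := density_mul_trace hC hj hreg
    convert! h2 using 1
    rw [hweq.fderiv_eq, hweq.eq_of_nhds, ← mul_assoc]
    change 0 = (fderiv ℝ j (s, Φ q s) (1, spaceTimeVelocity j (s, Φ q s))).1 * (Y s).det +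
      (j (s, Φ q s)).1 * _ * (Y s).det
    rw [h3]
    ring
  have hconst := constant_of_has_deriv_right_zero (fun s hs => (hdF s hs).continuousWithinAt)
    (fun s hs => (hdF s (Ico_subset_Icc_self hs)).mono_of_mem_nhdsWithin
      (Icc_mem_nhdsGE_of_mem hs)) t htb
  rw [hY0, hq.1] at hconst
  have hdet1 : (1 : Space d →L[ℝ] Space d).det = 1 := by
    simp [ContinuousLinearMap.det]
  rw [hdet1, mul_one] at hconst
  exact hconst

end Liouville

/-! ### Change of variables, equivariance, and finiteness of integrals along trajectories. -/

section Transport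

variable {d : ℕ} {C : Set (Space d)} {j : ℝ × Space d → ℝ × Space d}

theorem isOpen_domain_slice (hC : IsOpen C) (hj : IsCurrent C j) (t : ℝ) :
    IsOpen {q | (t, q) ∈ domain C j} :=
  (isOpen_domain hC hj).preimage (Continuous.prodMk_right t)

theorem continuousOn_sol_slice (hC : IsOpen C) (hj : IsCurrent C j) (t : ℝ) :
    ContinuousOn (sol C j t) {q | (t, q) ∈ domain C j} :=
  (continuousOn_sol hC hj).comp (Continuous.prodMk_right t).continuousOn fun _ hq => hq

theorem mem_of_mem_domain {t : ℝ} {q : Space d} (h : (t, q) ∈ domain C j) : q ∈ C := by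
  obtain ⟨Q, I, -, hQ⟩ := h
  have := hQ.mem 0 hQ.zero_mem
  rwa [hQ.initial] at this

theorem density_zero_pos (hj : IsCurrent C j) {t : ℝ} {q : Space d} (h : (t, q) ∈ domain C j) :
    0 < density j 0 q := by
  obtain ⟨Q, I, -, hQ⟩ := h
  have := density_pos hj (hQ.mem_regular hQ.zero_mem)
  rwa [hQ.initial] at this

/-- The flow is injective and its Jacobian is the ratio of the densities; both being positive, the
absolute value of the determinant drops out. -/
theorem lintegral_image_sol (hC : IsOpen C) (hj : IsCurrent C j) {t : ℝ} (ht : 0 ≤ t)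
    {B : Set (Space d)} (hB : MeasurableSet B) (hBD : B ⊆ {q | (t, q) ∈ domain C j})
    (g : Space d → ENNReal) :
    ∫⁻ q in sol C j t '' B, ENNReal.ofReal (density j t q) * g q =
      ∫⁻ q in B, ENNReal.ofReal (density j 0 q) * g (sol C j t q) := by
  choose! Y hY hYdet using fun q (hq : (t, q) ∈ domain C j) => exists_hasFDerivAt_sol hC hj ht hq
  rw [lintegral_image_eq_lintegral_abs_det_fderiv_mul volume hB
    (fun q hq => (hY q (hBD hq)).hasFDerivWithinAt) ((sol_injOn hC hj t).mono hBD)]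
  refine setLIntegral_congr_fun hB fun q hq => ?_
  have h1 : 0 < density j t (sol C j t q) := density_pos hj (sol_mem_regular hC hj (hBD hq))
  rw [← mul_assoc, ← ENNReal.ofReal_mul (abs_nonneg _), ← hYdet q (hBD hq)]
  congr 2
  have h2 : 0 < density j t (sol C j t q) * (Y q).det := by
    rw [hYdet q (hBD hq)]
    exact density_zero_pos hj (hBD hq)
  rw [abs_of_pos (pos_of_mul_pos_right h2 h1.le), mul_comm]

theorem aemeasurable_density (hC : IsOpen C) (hj : IsCurrent C j) (t : ℝ) :
    AEMeasurable (fun q => ENNReal.ofReal (density j t q)) (volume.restrict C) := by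
  refine ENNReal.measurable_ofReal.comp_aemeasurable (ContinuousOn.aemeasurable ?_ hC.measurableSet)
  exact continuous_fst.comp_continuousOn (hj.contDiffOn.continuousOn.comp
    (Continuous.prodMk_right t).continuousOn fun q hq => ⟨mem_univ _, hq⟩)

theorem mu_apply {t : ℝ} {A : Set (Space d)} (hA : MeasurableSet A) :
    mu C j t A = ∫⁻ q in A ∩ C, ENNReal.ofReal (density j t q) := by
  rw [mu, withDensity_apply _ hA, Measure.restrict_restrict hA]

theorem isProbabilityMeasure_mu (hj : IsCurrent C j) (t : ℝ) :
    IsProbabilityMeasure (mu C j t) :=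
  ⟨by rw [mu_apply MeasurableSet.univ, univ_inter, hj.normalized t]⟩

/-- Nodes carry no `μ_0`-mass, since `j⁰` vanishes there, and off the nodes solutions exist locally.
-/
theorem ae_zero_mem_domain (hC : IsOpen C) (hj : IsCurrent C j) :
    ∀ᵐ q ∂mu C j 0, (0, q) ∈ domain C j := by
  rw [mu, ae_withDensity_iff' (aemeasurable_density hC hj 0), ae_restrict_iff' hC.measurableSet]
  refine Eventually.of_forall fun q hq hne =>
    zero_mem_domain_of_mem_regular hC hj ⟨hq, fun h => hne ?_⟩
  simp [density, h]

/-- Surviving trajectories carry their mass into `A ∩ C` but need not fill it, so without global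
existence only an inequality results. -/
theorem mu_preimage_sol_le (hC : IsOpen C) (hj : IsCurrent C j) {t : ℝ} (ht : 0 ≤ t)
    {A : Set (Space d)} (hA : MeasurableSet A) :
    mu C j 0 ({q | (t, q) ∈ domain C j} ∩ sol C j t ⁻¹' A) ≤ mu C j t A := by
  have hm : MeasurableSet ({q | (t, q) ∈ domain C j} ∩ sol C j t ⁻¹' A) := by
    classical
    have hD := (isOpen_domain_slice hC hj t).measurableSet
    have hg := (continuousOn_sol_slice hC hj t).measurable_piecewise
      (continuousOn_const (c := (0 : Space d))) hD
    convert! hD.inter (hg hA) using 1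
    ext q
    refine and_congr_right fun hq => ?_
    rw [mem_preimage, mem_preimage, piecewise_eq_of_mem _ _ _ hq]
  have h1 := lintegral_image_sol hC hj ht hm inter_subset_left 1
  simp only [Pi.one_apply, mul_one] at h1
  rw [mu_apply hm, mu_apply hA, inter_eq_left.2 fun q hq => mem_of_mem_domain hq.1, ← h1]
  refine lintegral_mono_set ?_
  rintro _ ⟨q, hq, rfl⟩
  exact ⟨hq.2, (sol_mem_regular hC hj hq.1).1⟩

/-- If almost every solution exists up to time `t`, then the flow carries `μ_0` to `μ_t`. -/
theorem map_flow_eq (hC : IsOpen C) (hj : IsCurrent C j) {t : ℝ} (ht : 0 ≤ t)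
    (hae : ∀ᵐ q ∂mu C j 0, (t, q) ∈ domain C j) :
    (mu C j 0).map (flow C j t) = (mu C j t).map Sum.inl := by
  classical
  have := isProbabilityMeasure_mu hj 0
  have := isProbabilityMeasure_mu hj t
  set D : Set (Space d) := {q | (t, q) ∈ domain C j}
  have hD : MeasurableSet D := (isOpen_domain_slice hC hj t).measurableSet
  set g : Space d → Space d := D.piecewise (sol C j t) fun _ => 0
  have hg : Measurable g :=
    (continuousOn_sol_slice hC hj t).measurable_piecewise continuousOn_const hD
  have hgD : ∀ q ∈ D, g q = sol C j t q := fun q hq => D.piecewise_eq_of_mem _ _ hq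
  have hfg : flow C j t =ᵐ[mu C j 0] Sum.inl ∘ g := by
    filter_upwards [hae] with q hq
    rw [flow_eq hq, Function.comp_apply, hgD q hq]
  rw [Measure.map_congr hfg, ← Measure.map_map measurable_inl hg]
  congr 1
  have hle : (mu C j 0).map g ≤ mu C j t := by
    refine Measure.le_iff.2 fun A hA => ?_
    rw [Measure.map_apply hg hA]
    refine le_trans (measure_mono_ae ?_) (mu_preimage_sol_le hC hj ht hA)
    filter_upwards [hae] with q hq hqA
    refine ⟨hq, ?_⟩
    have hqA' : g q ∈ A := hqA
    rwa [hgD q hq] at hqA'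
  -- One probability measure below another must equal it.
  refine Measure.eq_of_le_of_measure_univ_eq hle ?_
  rw [Measure.map_apply hg MeasurableSet.univ, preimage_univ, measure_univ, measure_univ]

/-- Continuity is available only on the open regular set; extension by zero gives the joint
measurability that Tonelli needs. -/
theorem measurable_indicator_regular (hC : IsOpen C) (hj : IsCurrent C j) {F : Type*}
    [TopologicalSpace F] [MeasurableSpace F] [BorelSpace F] [Zero F] {f : ℝ × Space d → F}
    (hf : ContinuousOn f (regular C j)) : Measurable ((regular C j).indicator f) := by
  classical
  have h := hf.measurable_piecewise (continuousOn_const (c := (0 : F)))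
    (isOpen_regular hC hj).measurableSet
  exact piecewise_eq_indicator (s := regular C j) (f := f) ▸ h

theorem continuousOn_current (hj : IsCurrent C j) : ContinuousOn j (regular C j) :=
  hj.contDiffOn.continuousOn.mono fun _ hp => ⟨mem_univ _, hp.1⟩

/-- The integral of a space-time function, relative to the density, along the motion. -/
def motionIntegral (C : Set (Space d)) (j : ℝ × Space d → ℝ × Space d) (T : ℝ)
    (f : ℝ → Space d → ENNReal) (q : Space d) : ENNReal :=
  ∫⁻ t in Icc 0 T, (domain C j).indicator
    (fun p => f p.1 (sol C j p.1 p.2) / ENNReal.ofReal (density j p.1 (sol C j p.1 p.2))) (t, q)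

/-- Tonelli and the change of variables bound the `μ_0`-integral of `motionIntegral` over a bounded
`B` by the integral of `f` over the flowed sets, so the integrand is finite almost everywhere on
`B`. -/
theorem ae_motionIntegral_lt_top (hC : IsOpen C) (hj : IsCurrent C j) {T : ℝ}
    {f : ℝ → Space d → ENNReal}
    (hf : Measurable ((regular C j).indicator fun p => f p.1 p.2))
    (hfin : ∀ B, BoundedBorel C B →
      ∫⁻ t in Icc 0 T, ∫⁻ q in flowImage C j t B, f t q < ⊤) :
    ∀ᵐ q ∂mu C j 0, motionIntegral C j T f q < ⊤ := by
  classical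
  have := isProbabilityMeasure_mu hj 0
  set h : ℝ × Space d → ENNReal := (domain C j).indicator
    (fun p => f p.1 (sol C j p.1 p.2) / ENNReal.ofReal (density j p.1 (sol C j p.1 p.2))) with hh
  have hD := (isOpen_domain hC hj).measurableSet
  set m : ℝ × Space d → ℝ × Space d :=
    (domain C j).piecewise (fun p => (p.1, sol C j p.1 p.2)) fun _ => 0 with hm
  have hmm : Measurable m := (continuous_fst.continuousOn.prodMk
    (continuousOn_sol hC hj)).measurable_piecewise continuousOn_const hD
  have hdens : Measurable ((regular C j).indicator fun p => ENNReal.ofReal (j p).1) :=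
    measurable_indicator_regular hC hj (ENNReal.continuous_ofReal.comp_continuousOn
      (continuous_fst.comp_continuousOn (continuousOn_current hj)))
  have hhm : Measurable h := by
    have h1 := ((hf.comp hmm).div (hdens.comp hmm)).indicator hD
    convert! h1 using 1
    ext p
    by_cases hp : p ∈ domain C j
    · have hreg : (p.1, sol C j p.1 p.2) ∈ regular C j := sol_mem_regular hC hj hp
      simp [hh, hm, hp, hreg, density]
    · simp [hh, hp]
  have hfinB : ∀ B, BoundedBorel C B → ∀ᵐ q ∂(mu C j 0).restrict B,
      ∫⁻ t in Icc 0 T, h (t, q) < ⊤ := by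
    intro B hB
    refine ae_lt_top (hhm.lintegral_prod_left' (μ := volume.restrict (Icc 0 T))) (ne_of_lt ?_)
    rw [lintegral_lintegral_swap (f := fun q t => h (t, q))
      (hhm.comp measurable_swap).aemeasurable]
    refine lt_of_le_of_lt (setLIntegral_mono' measurableSet_Icc fun t ht => ?_) (hfin B hB)
    set D : Set (Space d) := {q | (t, q) ∈ domain C j} with hDt
    have hDm : MeasurableSet D := (isOpen_domain_slice hC hj t).measurableSet
    set g : Space d → ENNReal := fun x => f t x / ENNReal.ofReal (density j t x) with hg
    have hslice : (fun q => h (t, q)) = D.indicator fun q => g (sol C j t q) := by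
      ext q
      by_cases hq : (t, q) ∈ domain C j <;> simp [hh, hDt, hg, hq]
    have hht : Measurable fun q => h (t, q) := hhm.comp measurable_prodMk_left
    calc ∫⁻ q in B, h (t, q) ∂mu C j 0
        = ∫⁻ q in B, ENNReal.ofReal (density j 0 q) * h (t, q) := by
          rw [mu, restrict_withDensity hB.2.2, Measure.restrict_restrict hB.2.2,
            inter_eq_left.2 hB.1, lintegral_withDensity_eq_lintegral_mul₀
            ((aemeasurable_density hC hj 0).mono_set hB.1) hht.aemeasurable]
          rfl
      _ = ∫⁻ q in B, D.indicator
            (fun q => ENNReal.ofReal (density j 0 q) * g (sol C j t q)) q := by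
          refine lintegral_congr fun q => ?_
          rw [congrFun hslice q]
          by_cases hq : q ∈ D <;> simp [hq]
      _ = ∫⁻ q in B ∩ D, ENNReal.ofReal (density j 0 q) * g (sol C j t q) := by
          rw [lintegral_indicator hDm, Measure.restrict_restrict hDm, inter_comm]
      _ = ∫⁻ q in sol C j t '' (B ∩ D), ENNReal.ofReal (density j t q) * g q :=
          (lintegral_image_sol hC hj ht.1 (hB.2.2.inter hDm) inter_subset_right g).symm
      -- The inequality `a * (b / a) ≤ b` holds for all values in `ENNReal`, so positivity of the
      -- density need not be invoked.
      _ ≤ ∫⁻ q in sol C j t '' (B ∩ D), f t q := lintegral_mono fun q => ENNReal.mul_div_le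
      _ ≤ ∫⁻ q in flowImage C j t B, f t q := by
          refine lintegral_mono_set ?_
          rintro _ ⟨q, hq, rfl⟩
          exact ⟨q, hq.1, flow_eq hq.2⟩
  -- Countably many bounded sets exhaust `C`, so the exceptional null sets can be united.
  have hball : ∀ n : ℕ, BoundedBorel C (C ∩ closedBall 0 n) := fun n =>
    ⟨inter_subset_left, isBounded_closedBall.subset inter_subset_right,
      hC.measurableSet.inter isClosed_closedBall.measurableSet⟩
  have hall : ∀ᵐ q ∂mu C j 0, ∀ n : ℕ, q ∈ C ∩ closedBall 0 n →
      ∫⁻ t in Icc 0 T, h (t, q) < ⊤ :=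
    ae_all_iff.2 fun n => (ae_restrict_iff' (hball n).2.2).1 (hfinB _ (hball n))
  filter_upwards [hall, ae_zero_mem_domain hC hj] with q hq h0
  obtain ⟨n, hn⟩ := exists_nat_ge ‖q‖
  exact hq n ⟨mem_of_mem_domain h0, by simpa using hn⟩

end Transport

/-! ### Barrier estimates along trajectories. -/

section Estimates

/-- A continuous function whose derivative is integrable where the function exceeds a level `c` is
bounded. -/
theorem le_max_add_of_lintegral_le {y : ℝ → ℝ} {t c : ℝ} (ht : 0 ≤ t)
    (hy : ContinuousOn y (Icc 0 t)) {F : ℝ → ENNReal}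
    (hd : ∀ s ∈ Icc 0 t, c < y s →
      ∃ y', HasDerivAt y y' s ∧ ENNReal.ofReal |y'| ≤ F s)
    {M : ENNReal} (hM : M < ⊤) (hF : ∫⁻ s in Icc 0 t, F s ≤ M) :
    y t ≤ max (y 0) c + M.toReal := by
  obtain ⟨s₀, hs₀, hys₀, hgt⟩ : ∃ s₀ ∈ Icc 0 t, y s₀ ≤ max (y 0) c ∧ ∀ s ∈ Ioc s₀ t, c < y s := by
    rcases (Icc 0 t ∩ y ⁻¹' Iic c).eq_empty_or_nonempty with h | h
    · refine ⟨0, ⟨le_rfl, ht⟩, le_max_left _ _, fun s hs => ?_⟩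
      by_contra! hcon
      have : s ∈ Icc 0 t ∩ y ⁻¹' Iic c := ⟨Ioc_subset_Icc_self hs, hcon⟩
      rw [h] at this
      exact this
    · have hcpt : IsCompact (Icc 0 t ∩ y ⁻¹' Iic c) := isCompact_Icc.of_isClosed_subset
        (hy.preimage_isClosed_of_isClosed isClosed_Icc isClosed_Iic) inter_subset_left
      obtain ⟨s₀, hs₀, hmax⟩ := hcpt.exists_isGreatest h
      refine ⟨s₀, hs₀.1, le_max_of_le_right hs₀.2, fun s hs => ?_⟩
      by_contra! hcon
      exact hs.1.not_ge (hmax ⟨⟨hs₀.1.1.trans hs.1.le, hs.2⟩, hcon⟩)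
  have hsub : Ioc s₀ t ⊆ Icc 0 t := fun s hs => ⟨hs₀.1.trans hs.1.le, hs.2⟩
  have hder : ∀ s ∈ Ioc s₀ t, HasDerivAt y (deriv y s) s ∧ ‖deriv y s‖ₑ ≤ F s := fun s hs => by
    obtain ⟨y', hy', hle⟩ := hd s (hsub hs) (hgt s hs)
    rw [hy'.deriv]
    exact ⟨hy', by rwa [Real.enorm_eq_ofReal_abs]⟩
  have hint : ∫⁻ s in Ioc s₀ t, ‖deriv y s‖ₑ ≤ M :=
    (setLIntegral_mono' measurableSet_Ioc fun s hs => (hder s hs).2).trans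
      ((lintegral_mono_set hsub).trans hF)
  have hI : IntervalIntegrable (deriv y) volume s₀ t := by
    rw [intervalIntegrable_iff_integrableOn_Ioc_of_le hs₀.2]
    exact ⟨(measurable_deriv y).aestronglyMeasurable, hint.trans_lt hM⟩
  have hftc := intervalIntegral.integral_eq_sub_of_hasDerivAt_of_le hs₀.2
    (hy.mono (Icc_subset_Icc_left hs₀.1)) (fun s hs => (hder s (Ioo_subset_Ioc_self hs)).1) hI
  rw [intervalIntegral.integral_of_le hs₀.2] at hftc
  have h1 : ‖∫ s in Ioc s₀ t, deriv y s‖ₑ ≤ M := (enorm_integral_le_lintegral_enorm _).trans hint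
  have h2 : ‖∫ s in Ioc s₀ t, deriv y s‖ ≤ M.toReal := by
    rw [← toReal_enorm]
    exact ENNReal.toReal_mono hM.ne h1
  have h3 := (Real.le_norm_self _).trans h2
  linarith

variable {d : ℕ} {C : Set (Space d)} {j : ℝ × Space d → ℝ × Space d}

/-- Here `φ` is a barrier. The velocity contributes the factor `1 / j⁰`, which is the weight in
`motionIntegral`; the level `c` allows `φ` to be differentiable only where it is large. -/
theorem le_max_add_motionIntegral (hC : IsOpen C) (hj : IsCurrent C j) {T c : ℝ} {q : Space d}
    {f : ℝ → Space d → ENNReal} (hf : motionIntegral C j T f q < ⊤) {φ : ℝ × Space d → ℝ}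
    (hφ : ∀ p ∈ regular C j, ContinuousAt φ p)
    (hd : ∀ s, (s, q) ∈ domain C j → c < φ (s, sol C j s q) → ∃ y',
      HasDerivAt (fun s => φ (s, sol C j s q)) (y' / density j s (sol C j s q)) s ∧
        ENNReal.ofReal |y'| ≤ f s (sol C j s q)) :
    ∀ t ∈ Icc 0 T, (t, q) ∈ domain C j →
      φ (t, sol C j t q) ≤ max (φ (0, q)) c + (motionIntegral C j T f q).toReal := by
  intro t ht htq
  have hsol := isSolution_sol hC hj (zero_mem_domain htq)
  have hdom : ∀ s ∈ Icc 0 t, (s, q) ∈ domain C j := fun s hs => mem_domain_of_le htq hs.1 hs.2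
  have h0 : sol C j 0 q = q := hsol.initial
  have hle := le_max_add_of_lintegral_le (y := fun s => φ (s, sol C j s q)) (c := c) ht.1
    (fun s hs => ContinuousAt.continuousWithinAt <|
      ContinuousAt.comp (f := fun s => (s, sol C j s q)) (hφ _ (hsol.mem_regular (hdom s hs)))
        (continuousAt_id.prodMk (hsol.hasDerivAt (hdom s hs)).continuousAt))
    (F := fun t => (domain C j).indicator
      (fun p => f p.1 (sol C j p.1 p.2) / ENNReal.ofReal (density j p.1 (sol C j p.1 p.2))) (t, q))
    (fun s hs hc => ?_) hf (lintegral_mono_set (Icc_subset_Icc_right ht.2))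
  · simpa only [h0] using hle
  · obtain ⟨y', hy', hle⟩ := hd s (hdom s hs) hc
    have hpos : 0 < density j s (sol C j s q) := density_pos hj (hsol.mem_regular (hdom s hs))
    refine ⟨_, hy', ?_⟩
    rw [indicator_of_mem (hdom s hs), abs_div, abs_of_pos hpos, ENNReal.ofReal_div_of_pos hpos]
    gcongr

theorem hasDerivAt_sol (hC : IsOpen C) (hj : IsCurrent C j) {s : ℝ} {q : Space d}
    (h : (s, q) ∈ domain C j) :
    HasDerivAt (fun s => sol C j s q) (velocity j s (sol C j s q)) s :=
  (isSolution_sol hC hj (zero_mem_domain h)).hasDerivAt h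

/-- Solutions stay away from the nodes. -/
theorem exists_le_density (hC : IsOpen C) (hj : IsCurrent C j) {T : ℝ} {q : Space d}
    (hf : motionIntegral C j T (fun t q => ENNReal.ofReal |materialDeriv j t q|) q < ⊤) :
    ∃ ε > 0, ∀ t ∈ Icc 0 T, (t, q) ∈ domain C j → ε ≤ density j t (sol C j t q) := by
  obtain ⟨c, hc⟩ : ∃ c, ∀ t ∈ Icc 0 T, (t, q) ∈ domain C j →
      -Real.log (density j t (sol C j t q)) ≤ c := ⟨_, le_max_add_motionIntegral hC hj (c := 0) hf
    (φ := fun p => -Real.log (j p).1)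
    (fun p hp => by
      have := (contDiffAt_current hC hj hp).continuousAt
      exact (this.fst.log (density_pos hj hp).ne').neg)
    (fun s hs _ => by
      have hreg := sol_mem_regular hC hj hs
      have hd := (contDiffAt_current hC hj hreg).differentiableAt one_ne_zero
      have hv := hasDerivAt_sol hC hj hs
      have h1 := hd.hasFDerivAt.fst.comp_hasDerivAt s ((hasDerivAt_id s).prodMk hv)
      have h2 := (h1.log (density_pos hj hreg).ne').neg
      refine ⟨-materialDeriv j s (sol C j s q), ?_, by rw [abs_neg]⟩
      rw [materialDeriv_eq (p := (s, sol C j s q)) hd, neg_div]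
      exact h2)⟩
  refine ⟨_, Real.exp_pos (-c), fun t ht htq => ?_⟩
  have hpos : 0 < density j t (sol C j t q) := density_pos hj (sol_mem_regular hC hj htq)
  rw [← Real.le_log_iff_exp_le hpos]
  exact neg_le.1 (hc t ht htq)

/-- Solutions stay bounded. -/
theorem exists_norm_le (hC : IsOpen C) (hj : IsCurrent C j) {T : ℝ} {q : Space d}
    (hf : motionIntegral C j T
      (fun t q => ENNReal.ofReal |inner ℝ (flux j t q) (‖q‖⁻¹ • q)|) q < ⊤) :
    ∃ R, ∀ t ∈ Icc 0 T, (t, q) ∈ domain C j → ‖sol C j t q‖ ≤ R := by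
  -- Level `0` excludes the origin, where the norm is not differentiable.
  refine ⟨_, le_max_add_motionIntegral hC hj (c := 0) hf (φ := fun p => ‖p.2‖)
    (fun p _ => by fun_prop) fun s hs hc => ⟨_, ?_, le_rfl⟩⟩
  have hn : ‖sol C j s q‖ ≠ 0 := hc.ne'
  have h1 := (hasDerivAt_sol hC hj hs).norm_sq.sqrt (pow_ne_zero 2 hn)
  simp only [Real.sqrt_sq (norm_nonneg _)] at h1
  convert! h1 using 1
  rw [velocity, inner_smul_right, inner_smul_right, real_inner_comm]
  field_simp

/-- Solutions stay away from the singular sets. -/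
theorem exists_le_infDist (hC : IsOpen C) (hj : IsCurrent C j) {T δ : ℝ} (hδ : 0 < δ) {q : Space d}
    {S : Set (Space d)} (hS : Admissible S) (hne : S.Nonempty) (hSC : Disjoint S C)
    (hf : motionIntegral C j T (fun t => (thickening δ S).indicator fun q =>
        ENNReal.ofReal (|inner ℝ (flux j t q) (radialVector S q)| / infDist q S)) q < ⊤) :
    ∃ ε > 0, ∀ t ∈ Icc 0 T, (t, q) ∈ domain C j → ε ≤ infDist (sol C j t q) S := by
  obtain ⟨hScl, δ', hδ', hdiff⟩ := hS
  have hpos : ∀ x ∈ C, 0 < infDist x S := fun x hx =>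
    (hScl.notMem_iff_infDist_pos hne).1 (hSC.notMem_of_mem_right hx)
  obtain ⟨c, hc⟩ : ∃ c, ∀ t ∈ Icc 0 T, (t, q) ∈ domain C j →
      -Real.log (infDist (sol C j t q) S) ≤ c := ⟨_, le_max_add_motionIntegral hC hj
    -- Above this level the point is within `δ`, where the indicator is active, and within `δ'`,
    -- where the distance is differentiable.
    (c := -Real.log (min δ δ')) hf (φ := fun p => -Real.log (infDist p.2 S))
    (fun p hp => ((((continuous_infDist_pt S).comp continuous_snd).continuousAt (x := p)).log
      (hpos _ hp.1).ne').neg)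
    (fun s hs hc => by
      have hxC := (sol_mem_regular hC hj hs).1
      have hx := hpos _ hxC
      have hlt : infDist (sol C j s q) S < min δ δ' :=
        (Real.log_lt_log_iff hx (lt_min hδ hδ')).1 (neg_lt_neg_iff.1 hc)
      have hmem : ∀ r, infDist (sol C j s q) S < r → sol C j s q ∈ thickening r S := fun r hr =>
        (mem_thickening_iff_infDist_lt hne).2 hr
      have hd : DifferentiableAt ℝ (fun x => infDist x S) (sol C j s q) :=
        hdiff.differentiableAt ((isOpen_thickening.sdiff hScl).mem_nhds
          ⟨hmem _ (hlt.trans_le (min_le_right _ _)), hSC.notMem_of_mem_right hxC⟩)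
      have h1 := hd.hasGradientAt.hasFDerivAt.comp_hasDerivAt s (hasDerivAt_sol hC hj hs)
      have h2 := (h1.log hx.ne').neg
      refine ⟨inner ℝ (flux j s (sol C j s q)) (radialVector S (sol C j s q)) /
        infDist (sol C j s q) S, ?_, ?_⟩
      · convert! h2 using 1
        rw [InnerProductSpace.toDual_apply_apply, velocity, inner_smul_right, radialVector,
          inner_neg_right, real_inner_comm]
        simp only [Function.comp_apply]
        ring
      · rw [indicator_of_mem (hmem _ (hlt.trans_le (min_le_left _ _))), abs_div, abs_of_pos hx])⟩
  refine ⟨_, Real.exp_pos (-c), fun t ht htq => ?_⟩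
  rw [← Real.le_log_iff_exp_le (hpos _ (sol_mem_regular hC hj htq).1)]
  exact neg_le.1 (hc t ht htq)

theorem measurable_materialDeriv (hC : IsOpen C) (hj : IsCurrent C j) :
    Measurable ((regular C j).indicator
      fun p => ENNReal.ofReal |materialDeriv j p.1 p.2|) := by
  refine measurable_indicator_regular hC hj (ENNReal.continuous_ofReal.comp_continuousOn ?_)
  have h1 : ContinuousOn (fderiv ℝ j) (regular C j) :=
    (hj.contDiffOn.continuousOn_fderiv_of_isOpen (isOpen_univ.prod hC) le_rfl).mono
      fun p hp => ⟨mem_univ _, hp.1⟩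
  have h2 := (h1.clm_apply ((continuousOn_const (c := (1 : ℝ))).prodMk
    (contDiffOn_velocity hC hj).continuousOn)).fst.abs
  exact h2.congr fun p hp => by
    rw [materialDeriv_eq ((contDiffAt_current hC hj hp).differentiableAt one_ne_zero)]

theorem measurable_inner_flux (hC : IsOpen C) (hj : IsCurrent C j) {e : Space d → Space d}
    (he : Measurable e) {F : Space d → ℝ → ENNReal}
    (hF : Measurable fun p : Space d × ℝ => F p.1 p.2) :
    Measurable ((regular C j).indicator
      fun p => F p.2 |inner ℝ (flux j p.1 p.2) (e p.2)|) := by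
  have h1 := measurable_indicator_regular hC hj (continuousOn_current hj)
  have h2 : Measurable fun p : ℝ × Space d =>
      |inner ℝ ((regular C j).indicator j p).2 (e p.2)| :=
    (h1.snd.inner (𝕜 := ℝ) (he.comp measurable_snd)).norm
  have h3 := (hF.comp (measurable_snd.prodMk h2)).indicator (isOpen_regular hC hj).measurableSet
  convert! h3 using 1
  ext p
  by_cases hp : p ∈ regular C j <;> simp [hp, flux]

/-- Differentiability is assumed only near `S`, but `fderiv`, with value zero where no derivative
exists, is measurable everywhere. -/
theorem measurable_radialVector (S : Set (Space d)) : Measurable (radialVector S) :=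
  ((InnerProductSpace.toDual ℝ (Space d)).symm.continuous.measurable.comp
    (measurable_fderiv ℝ fun x => infDist x S)).neg

end Estimates

/-! ### Almost sure existence up to time `T`, and the theorem. -/

theorem isOpen_conf {d m : ℕ} {S : Fin m → Set (Space d)} (hS : ∀ ℓ, Admissible (S ℓ)) :
    IsOpen (conf S) :=
  (isClosed_iUnion_of_finite fun ℓ => (hS ℓ).1).isOpen_compl

theorem ae_mem_domain {d m : ℕ} {S : Fin m → Set (Space d)} (hS : ∀ ℓ, Admissible (S ℓ))
    {j : ℝ × Space d → ℝ × Space d} (hj : IsCurrent (conf S) j) {T : ℝ} (hT : 0 ≤ T)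
    (hnode : NodeCondition (conf S) j T) (hinf : InfinityCondition (conf S) j T)
    (hsing : ∀ ℓ, SingularCondition (conf S) j T (S ℓ)) :
    ∀ᵐ q ∂mu (conf S) j 0, (T, q) ∈ domain (conf S) j := by
  have hC := isOpen_conf hS
  choose δ hδ hsing using hsing
  have h1 := ae_motionIntegral_lt_top hC hj (measurable_materialDeriv hC hj) hnode
  have h2 := ae_motionIntegral_lt_top hC hj (measurable_inner_flux hC hj (e := fun q => ‖q‖⁻¹ • q)
    (by fun_prop) (F := fun _ x => ENNReal.ofReal x) (by fun_prop)) hinf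
  have h3 : ∀ ℓ, ∀ᵐ q ∂mu (conf S) j 0, motionIntegral (conf S) j T
      (fun t => (thickening (δ ℓ) (S ℓ)).indicator fun q => ENNReal.ofReal
        (|inner ℝ (flux j t q) (radialVector (S ℓ) q)| / infDist q (S ℓ))) q < ⊤ := fun ℓ => by
    refine ae_motionIntegral_lt_top hC hj (measurable_inner_flux hC hj
      (measurable_radialVector (S ℓ)) (F := fun x a => (thickening (δ ℓ) (S ℓ)).indicator
        (fun x => ENNReal.ofReal (a / infDist x (S ℓ))) x) ?_) (hsing ℓ)
    exact Measurable.indicator (f := fun p : Space d × ℝ => ENNReal.ofReal (p.2 / infDist p.1 (S ℓ)))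
      (by fun_prop) (measurable_fst isOpen_thickening.measurableSet)
  filter_upwards [h1, h2, ae_all_iff.2 h3, ae_zero_mem_domain hC hj] with q h1 h2 h3 h0
  obtain ⟨ε, hε, hε'⟩ := exists_le_density hC hj h1
  obtain ⟨R, hR⟩ := exists_norm_le hC hj h2
  have h3' : ∀ ℓ, ∃ η > 0, (S ℓ).Nonempty → ∀ t ∈ Icc 0 T, (t, q) ∈ domain (conf S) j →
      η ≤ infDist (sol (conf S) j t q) (S ℓ) := fun ℓ => by
    -- `infDist` to the empty set is `0` by convention, so an empty `S ℓ` must impose no lower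
    -- bound.
    by_cases hne : (S ℓ).Nonempty
    · obtain ⟨η, hη, hη'⟩ := exists_le_infDist hC hj (hδ ℓ) (hS ℓ) hne
        (disjoint_compl_right.mono_left (subset_iUnion S ℓ)) (h3 ℓ)
      exact ⟨η, hη, fun _ => hη'⟩
    · exact ⟨1, one_pos, fun h => absurd h hne⟩
  choose η hη hη' using h3'
  set N : Set (Space d) := closedBall 0 R ∩
    ⋂ ℓ, {x | (S ℓ).Nonempty → η ℓ ≤ infDist x (S ℓ)} with hN
  have hNcl : IsClosed (⋂ ℓ, {x | (S ℓ).Nonempty → η ℓ ≤ infDist x (S ℓ)}) :=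
    isClosed_iInter fun ℓ => by
      rw [ofPred_forall]
      exact isClosed_iInter fun _ => isClosed_le continuous_const (continuous_infDist_pt (S ℓ))
  have hNK : IsCompact (Icc 0 T ×ˢ N) :=
    isCompact_Icc.prod ((isCompact_closedBall 0 R).inter_right hNcl)
  have hNC : N ⊆ conf S := fun x hx hxS => by
    obtain ⟨ℓ, hℓ⟩ := mem_iUnion.1 hxS
    have := mem_iInter.1 hx.2 ℓ ⟨x, hℓ⟩
    rw [infDist_zero_of_mem hℓ] at this
    exact this.not_gt (hη ℓ)
  have hjc : ContinuousOn (fun p => (j p).1) (Icc 0 T ×ˢ N) :=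
    continuous_fst.comp_continuousOn
      (hj.contDiffOn.continuousOn.mono (prod_mono (subset_univ _) hNC))
  -- The three barriers define the compact set: bounded, away from every `S ℓ`, and with density at
  -- least `ε`, hence off the nodes.
  refine mem_domain_of_isCompact hC hj h0 hT
    (K := (Icc 0 T ×ˢ N) ∩ (fun p => (j p).1) ⁻¹' Ici ε)
    (hNK.of_isClosed_subset (hjc.preimage_isClosed_of_isClosed hNK.isClosed isClosed_Ici)
      inter_subset_left) (fun p hp => ⟨hNC hp.1.2, fun h => ?_⟩) fun t ht htq => ?_
  · have := hp.2
    simp only [mem_preimage, h, Prod.fst_zero, mem_Ici] at this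
    exact this.not_gt hε
  · exact ⟨⟨ht, mem_closedBall_zero_iff.2 (hR t ht htq),
      mem_iInter.2 fun ℓ hne => hη' ℓ hne t ht htq⟩, hε' t ht htq⟩

end BohmFlow

end

theorem theorem1 {d m : ℕ} (S : Fin m → Set (BohmFlow.Space d))
    (hS : ∀ ℓ, BohmFlow.Admissible (S ℓ))
    (j : ℝ × BohmFlow.Space d → ℝ × BohmFlow.Space d)
    (hj : BohmFlow.IsCurrent (BohmFlow.conf S) j) :
    (∀ T : ℝ, 0 < T →
      BohmFlow.NodeCondition (BohmFlow.conf S) j T →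
      BohmFlow.InfinityCondition (BohmFlow.conf S) j T →
      (∀ ℓ, BohmFlow.SingularCondition (BohmFlow.conf S) j T (S ℓ)) →
      (∀ᵐ q ∂(BohmFlow.mu (BohmFlow.conf S) j 0), ∃ (I : Set ℝ) (Q : ℝ → BohmFlow.Space d),
        BohmFlow.IsSolution (BohmFlow.conf S) j q I Q ∧ Icc 0 T ⊆ I) ∧
      BohmFlow.Equivariant (BohmFlow.conf S) j (Icc 0 T)) ∧
    ((∀ T : ℝ, 0 < T →
        BohmFlow.NodeCondition (BohmFlow.conf S) j T ∧
        BohmFlow.InfinityCondition (BohmFlow.conf S) j T ∧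
        ∀ ℓ, BohmFlow.SingularCondition (BohmFlow.conf S) j T (S ℓ)) →
      ∀ᵐ q ∂(BohmFlow.mu (BohmFlow.conf S) j 0), ∃ (I : Set ℝ) (Q : ℝ → BohmFlow.Space d),
        BohmFlow.IsSolution (BohmFlow.conf S) j q I Q ∧ Ici 0 ⊆ I) := by
  have hC := BohmFlow.isOpen_conf hS
  refine ⟨fun T hT h1 h2 h3 => ?_, fun h => ?_⟩
  · have hae := BohmFlow.ae_mem_domain hS hj hT.le h1 h2 h3
    refine ⟨?_, fun t ht => BohmFlow.map_flow_eq hC hj ht.1 ?_⟩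
    · filter_upwards [hae] with q hq
      exact ⟨_, _, BohmFlow.isSolution_sol hC hj (BohmFlow.zero_mem_domain hq),
        fun t ht => BohmFlow.mem_domain_of_le hq ht.1 ht.2⟩
    · filter_upwards [hae] with q hq
      exact BohmFlow.mem_domain_of_le hq ht.1 ht.2
  -- Countably many times suffice, since the existence interval is connected; `n + 1` keeps them
  -- positive.
  · have hae : ∀ᵐ q ∂(BohmFlow.mu (BohmFlow.conf S) j 0), ∀ n : ℕ,
        ((n : ℝ) + 1, q) ∈ BohmFlow.domain (BohmFlow.conf S) j := ae_all_iff.2 fun n => by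
      have hn : (0 : ℝ) < n + 1 := by positivity
      obtain ⟨h1, h2, h3⟩ := h _ hn
      exact BohmFlow.ae_mem_domain hS hj hn.le h1 h2 h3
    filter_upwards [hae] with q hq
    refine ⟨_, _, BohmFlow.isSolution_sol hC hj (BohmFlow.zero_mem_domain (hq 0)), fun t ht => ?_⟩
    obtain ⟨n, hn⟩ := exists_nat_ge t
    exact BohmFlow.mem_domain_of_le (hq n) ht (by linarith)
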